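/- Let $\mathrm{Nil}_1^3$ be $\mathbb R^3$ with the product $(x_1,x_2,x_3)\cdot(\tilde x_1,\tilde x_2,\tilde x_3)=(x_1+\tilde x_1,\,x_2+\tilde x_2,\,x_3+\tilde x_3+\frac12(x_1\tilde x_2-\tilde x_1x_2))$ and the left-invariant Lorentzian metric $dx_1^2+dx_2^2-(dx_3+\frac12(x_2dx_1-x_1dx_2))^2$; let $e_1=\partial_1-\frac{x_2}2\partial_3$, $e_2=\partial_2+\frac{x_1}2\partial_3$, $e_3=\partial_3$ be the left-invariant orthonormal frame. Let $\mathbb D\subset\mathbb C$ be a simply connected domain and let $f:\mathbb D\to\mathrm{Nil}_1^3$ be a (smooth) conformal maximal immersion, i.e. spacelike with induced metric $e^u|dz|^2$ and with mean curvature zero. Let $\psi_1,\psi_2$ be smooth generating spinors of $f$, i.e. $f^{-1}f_z=\sum_k\varphi_ke_k$ with $$\varphi_1=\overline{\psi_2}^{\,2}-\psi_1^2,\qquad \varphi_2=i(\overline{\psi_2}^{\,2}+\psi_1^2),\qquad \varphi_3=2i\psi_1\overline{\psi_2}.$$ Let $N$ be a smooth unit normal along $f$ (either choice of sign), let $h=\langle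 f^{-1}(e^{u/2}N),e_3\rangle$ be the support function (nowhere zero, with $|h|=2(|\psi_1|^2+|\psi_2|^2)$), let $g=\pi\circ(f^{-1}N)$ be the normal Gauss map, where $\pi$ is the stereographic projection of the hyperboloid of unit timelike vectors from $-e_3$ to $\mathbb C\cup\{\infty\}$, and let $B\,dz^2$, $B=\frac12\big(\psi_1(\overline{\psi_2})_z-\overline{\psi_2}(\psi_1)_z\big)$, be the Abresch--Rosenberg differential. Assume $B\not\equiv0$ and put $R=\{z\in\mathbb D: B(z)\ne0\}$. Wherever a holomorphic branch $\sqrt{-B}$ is given (one exists near every point of $R$), put $\sqrt{-\overline B}=\overline{\sqrt{-B}}$ and define the dual spinors $$\psi_1^*=\frac{4\sqrt{-B}}h\,\psi_2,\qquad \psi_2^*=\frac{4\sqrt{-\overline B}}h\,\psi_1 .$$ Then there is a smooth map $f^*:\mathbb D\to\mathrm{Nil}_1^3$ whose generating spinors are $\psi_1^*,\psi_2^*$ (over every open set with a branch of $\sqrt{-B}$), and $f^*$ is a conformal maximal immersion on $R$. Its Dirac potential is $U^*=V^*=-4|B|/|h|$, that is, its spinors satisfy $\partial_z\psi_2^*+U^*\psi_1^*=0$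 and $-\partial_{\bar z}\psi_1^*+V^*\psi_2^*=0$; its left-translated unit normal equals $f^{-1}N$ up to sign. Moreover: 1. If the unit normal $N^*$ of $f^*$ is chosen so that $(f^*)^{-1}N^*=f^{-1}N$, then the metric $e^{u^*}|dz|^2$, support function $h^*$, Abresch--Rosenberg differential $B^*dz^2$ and normal Gauss map $g^*$ of $f^*$ are $$e^{u^*}=\frac{16^2|B|^2}{h^4}e^u,\qquad h^*=\frac{16|B|}h,\qquad B^*=B,\qquad g^*=g .$$ 2. $f^{**}=f$ up to a rigid motion: $f$ is generated on $R$ by the dual spinors of $f^*$, and every map $f^{**}$ generated on $R$ by the dual spinors of $f^*$ is the composition of $f$ with a left translation, which is an isometry of $\mathrm{Nil}_1^3$. The zeros of $B$ are branch points of $f^*$: near such a point $z_0$, $(f^*)^{-1}f^*_z=(z-z_0)^k\Phi$ with an integer $k\ge1$ and a smooth $\Phi$ for which the real and imaginary parts of $\Phi(z_0)$ are linearly independent. -/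

import Mathlib

open scoped ContDiff ComplexConjugate

namespace NilDual

noncomputable section

/-! ### The Lorentzian Heisenberg group -/

/-- Points of the Heisenberg group in global coordinates, and elements of its Lie algebra written
in the left-invariant frame `e₁, e₂, e₃`. -/
abbrev Vec3 := Fin 3 → ℝ

/-- The product of the Heisenberg group `Nil³`. -/
def nilMul (p q : Vec3) : Vec3 :=
  ![p 0 + q 0, p 1 + q 1, p 2 + q 2 + (1 / 2) * (p 0 * q 1 - q 0 * p 1)]

/-- The Lorentzian scalar product on the Lie algebra for which `e₁, e₂, e₃` is orthonormal with
`e₃` timelike. -/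
def lor (X Y : Vec3) : ℝ := X 0 * Y 0 + X 1 * Y 1 - X 2 * Y 2

/-- The left-invariant Maurer-Cartan form: the components, with respect to the left-invariant frame
`e₁ = ∂₁ - (x₂/2) ∂₃`, `e₂ = ∂₂ + (x₁/2) ∂₃`, `e₃ = ∂₃`, of the tangent vector with coordinates `v`
at the point `p`. -/
def maurerCartan (p v : Vec3) : Vec3 :=
  ![v 0, v 1, v 2 + (1 / 2) * (p 1 * v 0 - p 0 * v 1)]

/-- The left-invariant metric `dx₁² + dx₂² - (dx₃ + (x₂ dx₁ - x₁ dx₂)/2)²` of `Nil₁³`. -/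
def nilMetric (p v w : Vec3) : ℝ := lor (maurerCartan p v) (maurerCartan p w)

/-- A rigid motion of `Nil₁³`: a smooth bijection that preserves the metric. -/
def IsRigidMotion (T : Vec3 → Vec3) : Prop :=
  ContDiff ℝ ∞ T ∧ Function.Bijective T ∧
    ∀ p v w, nilMetric (T p) (fderiv ℝ T p v) (fderiv ℝ T p w) = nilMetric p v w

/-- The Lie bracket: `[e₁, e₂] = e₃`, the other brackets of basis vectors vanish. -/
def nilBracket (X Y : Vec3) : Vec3 := ![0, 0, X 0 * Y 1 - X 1 * Y 0]

/-- The Levi-Civita connection of `Nil₁³` on left-invariant vector fields. It is the only one that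
satisfies the two lemmas below. -/
def nilConn (X Y : Vec3) : Vec3 :=
  ![-(1 / 2) * (X 1 * Y 2 + X 2 * Y 1), (1 / 2) * (X 0 * Y 2 + X 2 * Y 0),
    (1 / 2) * (X 0 * Y 1 - X 1 * Y 0)]

/-- The connection is torsion-free. -/
lemma nilConn_torsionFree (X Y : Vec3) : nilConn X Y - nilConn Y X = nilBracket X Y := by
  funext i
  fin_cases i <;> simp [nilConn, nilBracket] <;> ring

/-- The connection is compatible with the metric. -/
lemma nilConn_metric (X Y Z : Vec3) : lor (nilConn X Y) Z + lor Y (nilConn X Z) = 0 := by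
  simp [nilConn, lor]
  ring

/-! ### Wirtinger derivatives -/

/-- `∂u/∂z`. -/
def dZ (u : ℂ → ℂ) (z : ℂ) : ℂ :=
  (1 / 2) * (fderiv ℝ u z 1 - Complex.I * fderiv ℝ u z Complex.I)

/-- `∂u/∂z̄`. -/
def dZbar (u : ℂ → ℂ) (z : ℂ) : ℂ :=
  (1 / 2) * (fderiv ℝ u z 1 + Complex.I * fderiv ℝ u z Complex.I)

/-! ### Surfaces in `Nil₁³`

A surface is given by a map `f : ℂ → Vec3`, considered only on an open set of the conformal
parameter `z = x + iy`. -/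

/-- The left-translated derivative `f⁻¹ df(v)`. -/
def leftDeriv (f : ℂ → Vec3) (z v : ℂ) : Vec3 := maurerCartan (f z) (fderiv ℝ f z v)

/-- The components `φ₁, φ₂, φ₃` of `f⁻¹ f_z`. -/
def mcZ (f : ℂ → Vec3) (z : ℂ) (k : Fin 3) : ℂ :=
  (1 / 2) * ((leftDeriv f z 1 k : ℂ) - Complex.I * (leftDeriv f z Complex.I k : ℂ))

/-- The first fundamental form. -/
def firstForm (f : ℂ → Vec3) (z v w : ℂ) : ℝ := lor (leftDeriv f z v) (leftDeriv f z w)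

/-- The factor `e^u` of the induced metric `e^u |dz|²` of a conformal surface. -/
def metricFactor (f : ℂ → Vec3) (z : ℂ) : ℝ := firstForm f z 1 1

/-- `m` is (the left translate of) a unit normal of `f` at `z`. The normals of a spacelike surface
are timelike. -/
def IsUnitNormalAt (f : ℂ → Vec3) (z : ℂ) (m : Vec3) : Prop :=
  lor m m = -1 ∧ ∀ v, lor (leftDeriv f z v) m = 0

/-- `n = f⁻¹ N` for a smooth unit normal field `N` along `f` over `Ω`; no choice of sign is made. -/
def IsUnitNormal (Ω : Set ℂ) (f n : ℂ → Vec3) : Prop :=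
  ContDiffOn ℝ ∞ n Ω ∧ ∀ z ∈ Ω, IsUnitNormalAt f z (n z)

/-- The covariant derivative in direction `v` of the vector field `df(w)` along `f`, left-translated
to the Lie algebra. -/
def covDeriv (f : ℂ → Vec3) (z v w : ℂ) : Vec3 :=
  fderiv ℝ (fun ζ => leftDeriv f ζ w) z v + nilConn (leftDeriv f z v) (leftDeriv f z w)

/-- The second fundamental form with respect to the unit normal `m`. -/
def secondForm (f : ℂ → Vec3) (m : Vec3) (z v w : ℂ) : ℝ := lor (covDeriv f z v w) m

/-- The mean curvature of a spacelike surface at `z` with respect to the timelike unit normal `m`: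
the mean curvature vector is `meanCurvature f m z • m`. -/
def meanCurvature (f : ℂ → Vec3) (m : Vec3) (z : ℂ) : ℝ :=
  -(firstForm f z Complex.I Complex.I * secondForm f m z 1 1
      - 2 * firstForm f z 1 Complex.I * secondForm f m z 1 Complex.I
      + firstForm f z 1 1 * secondForm f m z Complex.I Complex.I)
    / (2 * (firstForm f z 1 1 * firstForm f z Complex.I Complex.I
      - firstForm f z 1 Complex.I ^ 2))

/-- `f` is, over the open set `Ω`, a conformal maximal immersion: a smooth map whose induced metric
is `e^u |dz|²` with `e^u > 0` (so that `f` is a spacelike immersion) and whose mean curvature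
vanishes. -/
structure IsConformalMaximal (Ω : Set ℂ) (f : ℂ → Vec3) : Prop where
  smooth : ContDiffOn ℝ ∞ f Ω
  spacelike : ∀ z ∈ Ω, 0 < metricFactor f z
  conformal : ∀ z ∈ Ω, firstForm f z Complex.I Complex.I = metricFactor f z ∧
    firstForm f z 1 Complex.I = 0
  maximal : ∀ z ∈ Ω, ∀ m, IsUnitNormalAt f z m → meanCurvature f m z = 0

/-- The support function `⟨f⁻¹L, e₃⟩`, `L = e^{u/2} N`, where `n = f⁻¹ N`. -/
def supportFn (f n : ℂ → Vec3) (z : ℂ) : ℝ :=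
  lor (Real.sqrt (metricFactor f z) • n z) ![0, 0, 1]

/-- The stereographic projection of the two-sheeted unit hyperboloid of timelike unit vectors from
the south pole `-e₃`. It sends `(2 Im g, -2 Re g, -(|g|² + 1)) / (|g|² - 1)` to `g`. -/
def stereo (m : Vec3) : OnePoint ℂ :=
  if m 2 = -1 then OnePoint.infty
  else (((m 1 : ℂ) - Complex.I * (m 0 : ℂ)) / (1 + (m 2 : ℂ)) : ℂ)

/-- The normal Gauss map `π ∘ (f⁻¹ N)`, where `n = f⁻¹ N`. -/
def gaussMap (n : ℂ → Vec3) (z : ℂ) : OnePoint ℂ := stereo (n z)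

/-- `ψ₁, ψ₂` are (smooth) generating spinors of `f` over `Ω`. -/
structure IsGeneratingSpinors (Ω : Set ℂ) (f : ℂ → Vec3) (ψ₁ ψ₂ : ℂ → ℂ) : Prop where
  smooth₁ : ContDiffOn ℝ ∞ ψ₁ Ω
  smooth₂ : ContDiffOn ℝ ∞ ψ₂ Ω
  phi₁ : ∀ z ∈ Ω, mcZ f z 0 = conj (ψ₂ z) ^ 2 - ψ₁ z ^ 2
  phi₂ : ∀ z ∈ Ω, mcZ f z 1 = Complex.I * (conj (ψ₂ z) ^ 2 + ψ₁ z ^ 2)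
  phi₃ : ∀ z ∈ Ω, mcZ f z 2 = 2 * Complex.I * ψ₁ z * conj (ψ₂ z)

/-- The coefficient `B` of the Abresch-Rosenberg differential of a surface of mean curvature zero
with generating spinors `ψ₁, ψ₂`. -/
def abreschRosenberg (ψ₁ ψ₂ : ℂ → ℂ) (z : ℂ) : ℂ :=
  (1 / 2) * (ψ₁ z * dZ (fun ζ => conj (ψ₂ ζ)) z - conj (ψ₂ z) * dZ ψ₁ z)

/-- The nonlinear Dirac equation with Dirac potential `U = V = P`. -/
def SatisfiesDirac (Ω : Set ℂ) (P ψ₁ ψ₂ : ℂ → ℂ) : Prop :=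
  ∀ z ∈ Ω, dZ ψ₂ z + P z * ψ₁ z = 0 ∧ -dZbar ψ₁ z + P z * ψ₂ z = 0

/-! ### Duality -/

/-- `s` is a holomorphic branch of `√(-B)` over `Ω`. -/
def IsSqrtBranch (Ω : Set ℂ) (B s : ℂ → ℂ) : Prop :=
  DifferentiableOn ℂ s Ω ∧ ∀ z ∈ Ω, s z ^ 2 = -B z

/-- The first dual spinor `4 √(-B) ψ₂ / h`, with `s = √(-B)`. -/
def dualSpinor₁ (s : ℂ → ℂ) (h : ℂ → ℝ) (ψ₂ : ℂ → ℂ) (z : ℂ) : ℂ :=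
  4 * s z / (h z : ℂ) * ψ₂ z

/-- The second dual spinor `4 √(-B̄) ψ₁ / h`, where `√(-B̄)` is the conjugate of `s = √(-B)`. -/
def dualSpinor₂ (s : ℂ → ℂ) (h : ℂ → ℝ) (ψ₁ : ℂ → ℂ) (z : ℂ) : ℂ :=
  4 * conj (s z) / (h z : ℂ) * ψ₁ z

/-- Over `Ω`, the smooth map `F` is generated by the dual spinors of the surface `f` with
left-translated unit normal `n`. Spinors and branches of `√(-B)` exist only locally in general (a
zero of odd order of `B` is a branch point of `√(-B)`), so this is required over every open subset
on which they are given. -/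
def IsDualSurface (Ω : Set ℂ) (f n F : ℂ → Vec3) : Prop :=
  ContDiffOn ℝ ∞ F Ω ∧
    ∀ V ⊆ Ω, IsOpen V → ∀ χ₁ χ₂ s : ℂ → ℂ, IsGeneratingSpinors V f χ₁ χ₂ →
      IsSqrtBranch V (abreschRosenberg χ₁ χ₂) s →
        IsGeneratingSpinors V F (dualSpinor₁ s (supportFn f n) χ₂)
          (dualSpinor₂ s (supportFn f n) χ₁)

/-- `z₀` is a branch point of `F`: near `z₀` one has `F⁻¹ F_z = (z - z₀)^k Φ` with `k ≥ 1` and a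
smooth `Φ` such that the real and imaginary parts of `Φ(z₀)` span a plane. In particular
`dF = 0` at `z₀`. -/
def IsBranchPoint (F : ℂ → Vec3) (z₀ : ℂ) : Prop :=
  ∃ k : ℕ, 1 ≤ k ∧ ∃ Φ : ℂ → Fin 3 → ℂ, ContDiffAt ℝ ∞ Φ z₀ ∧
    LinearIndependent ℝ ![fun i => (Φ z₀ i).re, fun i => (Φ z₀ i).im] ∧
    ∀ᶠ z in nhds z₀, ∀ i, mcZ F z i = (z - z₀) ^ k * Φ z i

end

end NilDual

namespace NilDual

/-! ### Wirtinger calculus -/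

section Wirtinger

variable {u v : ℂ → ℂ} {z : ℂ}

/-! Duality acts on the form `φ = f⁻¹ f_z` by `φ* = (16 B / h²) φ̄`. Spinors enter `φ`
quadratically, so only the square `-B` of the root survives: `φ*` is independent of the branch and
smooth on all of `D`, zeros of `B` included.

To see that `φ*` comes from a harmonic map, put `a = ψ̄₂`, `b = ψ₁`, `S = |a|² + |b|²`. Maximality
of `f` is a Dirac equation for `(a, b)` with potential `-S/2`; it makes the half Wronskian `B`
holomorphic, and `h² = 4S²`. In terms of `α = ā/S`, `β = b̄/S` the components of `φ*` are `B` times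
quadratic forms in `α, β`. The pair `(α, β)` solves a system of Dirac type with coefficient `2 B̄
(|α|² + |β|²)` (`IsDiracPair.exists_normalised`), and together with `B_z̄ = 0` this yields the
harmonic map equations (`dual_harmonic_equations`). Their imaginary parts are the integrability
conditions, so the form integrates on the simply connected `D` (`exists_mcZ_eq`); their real parts
say that the tension field vanishes, which for a conformal immersion gives zero mean curvature.

Pointwise, `φ* = l φ̄` means that the left-translated differential of `f*` at `v` is that of `f` at
`conj (l v)` (`leftDeriv_dual`). Where `l ≠ 0` the tangent planes agree, so the normal and the Gauss
map are kept, the metric is multiplied by `|l|²`, and `h* = |l| h = 16 |B| / h`. In the Wronskian of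
the dual spinors the derivative of their common factor cancels, and the Dirac equation gives `B* =
B`. Dualising twice multiplies `φ` by `256 |B|² / (h h*)² = 1`. Maps with the same form on the
domain `R` differ by a left translation (`exists_eq_nilMul`); `R` is connected because the zeros of
`B` are isolated. At a zero, the order of vanishing of `B` is the branching order. -/

lemma dZ_congr (h : u =ᶠ[nhds z] v) : dZ u z = dZ v z := by
  simp [dZ, h.fderiv_eq]

lemma dZbar_congr (h : u =ᶠ[nhds z] v) : dZbar u z = dZbar v z := by
  simp [dZbar, h.fderiv_eq]

lemma dZ_congr_of_isOpen {V : Set ℂ} (hV : IsOpen V) (h : Set.EqOn u v V) (hz : z ∈ V) :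
    dZ u z = dZ v z :=
  dZ_congr (h.eventuallyEq_of_mem (hV.mem_nhds hz))

lemma dZbar_congr_of_isOpen {V : Set ℂ} (hV : IsOpen V) (h : Set.EqOn u v V) (hz : z ∈ V) :
    dZbar u z = dZbar v z :=
  dZbar_congr (h.eventuallyEq_of_mem (hV.mem_nhds hz))

lemma dZ_add (hu : DifferentiableAt ℝ u z) (hv : DifferentiableAt ℝ v z) :
    dZ (fun w => u w + v w) z = dZ u z + dZ v z := by
  simp only [dZ, fderiv_fun_add hu hv, add_apply]
  ring

lemma dZbar_add (hu : DifferentiableAt ℝ u z) (hv : DifferentiableAt ℝ v z) :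
    dZbar (fun w => u w + v w) z = dZbar u z + dZbar v z := by
  simp only [dZbar, fderiv_fun_add hu hv, add_apply]
  ring

lemma dZbar_sub (hu : DifferentiableAt ℝ u z) (hv : DifferentiableAt ℝ v z) :
    dZbar (fun w => u w - v w) z = dZbar u z - dZbar v z := by
  simp only [dZbar, fderiv_fun_sub hu hv, sub_apply]
  ring

lemma dZ_mul (hu : DifferentiableAt ℝ u z) (hv : DifferentiableAt ℝ v z) :
    dZ (fun w => u w * v w) z = dZ u z * v z + u z * dZ v z := by
  simp only [dZ, fderiv_fun_mul hu hv, add_apply,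
    smul_apply, smul_eq_mul]
  ring

lemma dZbar_mul (hu : DifferentiableAt ℝ u z) (hv : DifferentiableAt ℝ v z) :
    dZbar (fun w => u w * v w) z = dZbar u z * v z + u z * dZbar v z := by
  simp only [dZbar, fderiv_fun_mul hu hv, add_apply,
    smul_apply, smul_eq_mul]
  ring

lemma dZ_const (c : ℂ) : dZ (fun _ => c) z = 0 := by simp [dZ]

lemma dZbar_const (c : ℂ) : dZbar (fun _ => c) z = 0 := by simp [dZbar]

lemma dZ_const_mul (c : ℂ) (hu : DifferentiableAt ℝ u z) :
    dZ (fun w => c * u w) z = c * dZ u z := by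
  rw [dZ_mul (differentiableAt_const c) hu, dZ_const]; ring

lemma dZbar_const_mul (c : ℂ) (hu : DifferentiableAt ℝ u z) :
    dZbar (fun w => c * u w) z = c * dZbar u z := by
  rw [dZbar_mul (differentiableAt_const c) hu, dZbar_const]; ring

lemma dZ_sq (hu : DifferentiableAt ℝ u z) :
    dZ (fun w => u w ^ 2) z = 2 * u z * dZ u z := by
  simp only [pow_two]; rw [dZ_mul hu hu]; ring

lemma dZbar_sq (hu : DifferentiableAt ℝ u z) :
    dZbar (fun w => u w ^ 2) z = 2 * u z * dZbar u z := by
  simp only [pow_two]; rw [dZbar_mul hu hu]; ring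

lemma fderiv_conj_apply (hu : DifferentiableAt ℝ u z) (w : ℂ) :
    fderiv ℝ (fun ζ => conj (u ζ)) z w = conj (fderiv ℝ u z w) := by
  have h := (Complex.conjCLE : ℂ →L[ℝ] ℂ).hasFDerivAt.comp z hu.hasFDerivAt
  have h' : HasFDerivAt (fun ζ => conj (u ζ))
    ((Complex.conjCLE : ℂ →L[ℝ] ℂ).comp (fderiv ℝ u z)) z := h
  rw [h'.fderiv]
  simp

lemma _root_.DifferentiableAt.complex_conj (hu : DifferentiableAt ℝ u z) :
    DifferentiableAt ℝ (fun ζ => conj (u ζ)) z :=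
  (Complex.conjCLE : ℂ →L[ℝ] ℂ).differentiableAt.comp z hu

lemma _root_.ContDiffOn.complex_conj {V : Set ℂ} {n : WithTop ℕ∞} (hu : ContDiffOn ℝ n u V) :
    ContDiffOn ℝ n (fun ζ => conj (u ζ)) V :=
  (Complex.conjCLE : ℂ →L[ℝ] ℂ).contDiff.comp_contDiffOn hu

lemma dZ_conj (hu : DifferentiableAt ℝ u z) :
    dZ (fun ζ => conj (u ζ)) z = conj (dZbar u z) := by
  simp only [dZ, dZbar, fderiv_conj_apply hu, map_mul, map_div₀, map_one, map_ofNat, map_add,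
    Complex.conj_I]
  ring

lemma dZbar_conj (hu : DifferentiableAt ℝ u z) :
    dZbar (fun ζ => conj (u ζ)) z = conj (dZ u z) := by
  simp only [dZ, dZbar, fderiv_conj_apply hu, map_mul, map_div₀, map_one, map_ofNat, map_sub,
    Complex.conj_I]
  ring

lemma fderiv_ofReal_apply {r : ℂ → ℝ} (hr : DifferentiableAt ℝ r z) (w : ℂ) :
    fderiv ℝ (fun ζ => (r ζ : ℂ)) z w = (fderiv ℝ r z w : ℂ) := by
  have h : HasFDerivAt (fun ζ => (r ζ : ℂ)) (Complex.ofRealCLM.comp (fderiv ℝ r z)) z :=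
    Complex.ofRealCLM.hasFDerivAt.comp z hr.hasFDerivAt
  rw [h.fderiv]
  simp

lemma _root_.DifferentiableAt.complex_ofReal {r : ℂ → ℝ} (hr : DifferentiableAt ℝ r z) :
    DifferentiableAt ℝ (fun ζ => (r ζ : ℂ)) z :=
  Complex.ofRealCLM.differentiableAt.comp z hr

lemma _root_.ContDiffOn.complex_ofReal {V : Set ℂ} {n : WithTop ℕ∞} {r : ℂ → ℝ}
    (hr : ContDiffOn ℝ n r V) : ContDiffOn ℝ n (fun ζ => (r ζ : ℂ)) V :=
  Complex.ofRealCLM.contDiff.comp_contDiffOn hr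

lemma dZbar_ofReal {r : ℂ → ℝ} (hr : DifferentiableAt ℝ r z) :
    dZbar (fun ζ => (r ζ : ℂ)) z = conj (dZ (fun ζ => (r ζ : ℂ)) z) := by
  simp only [dZ, dZbar, fderiv_ofReal_apply hr, map_mul, map_div₀, map_one, map_ofNat, map_sub,
    Complex.conj_I, Complex.conj_ofReal]
  ring

lemma differentiableAt_of_dZbar_eq_zero (hu : DifferentiableAt ℝ u z) (h : dZbar u z = 0) :
    DifferentiableAt ℂ u z := by
  rw [differentiableAt_complex_iff_differentiableAt_real]
  refine ⟨hu, ?_⟩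
  have h' : fderiv ℝ u z 1 + Complex.I * fderiv ℝ u z Complex.I = 0 := by
    simpa [dZbar] using h
  rw [smul_eq_mul]
  linear_combination -Complex.I * h' + fderiv ℝ u z Complex.I * Complex.I_sq

lemma contDiffOn_fderiv_apply {E F : Type*} [NormedAddCommGroup E] [NormedSpace ℝ E]
    [NormedAddCommGroup F] [NormedSpace ℝ F] {V : Set E} (hV : IsOpen V) {f : E → F}
    (hf : ContDiffOn ℝ ∞ f V) (w : E) : ContDiffOn ℝ ∞ (fun ζ => fderiv ℝ f ζ w) V :=
  (hf.fderiv_of_isOpen hV (by simp)).clm_apply contDiffOn_const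

lemma contDiffOn_dZ {V : Set ℂ} (hV : IsOpen V) (hu : ContDiffOn ℝ ∞ u V) :
    ContDiffOn ℝ ∞ (dZ u) V :=
  contDiffOn_const.mul ((contDiffOn_fderiv_apply hV hu 1).sub
    (contDiffOn_const.mul (contDiffOn_fderiv_apply hV hu Complex.I)))

lemma _root_.ContDiffOn.differentiableAt_of_isOpen {E F : Type*} [NormedAddCommGroup E]
    [NormedSpace ℝ E] [NormedAddCommGroup F] [NormedSpace ℝ F] {V : Set E} {f : E → F}
    (hf : ContDiffOn ℝ ∞ f V) (hV : IsOpen V) {x : E} (hx : x ∈ V) : DifferentiableAt ℝ f x :=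
  (hf.contDiffAt (hV.mem_nhds hx)).differentiableAt (by simp)

lemma fderiv_fderiv_apply_comm {E F : Type*} [NormedAddCommGroup E] [NormedSpace ℝ E]
    [NormedAddCommGroup F] [NormedSpace ℝ F] {V : Set E} (hV : IsOpen V) {f : E → F}
    (hf : ContDiffOn ℝ ∞ f V) {x : E} (hx : x ∈ V) (v w : E) :
    fderiv ℝ (fun ζ => fderiv ℝ f ζ v) x w = fderiv ℝ (fun ζ => fderiv ℝ f ζ w) x v := by
  have hd : DifferentiableAt ℝ (fderiv ℝ f) x :=
    ContDiffOn.differentiableAt_of_isOpen (hf.fderiv_of_isOpen hV (by simp)) hV hx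
  have key (v w : E) : fderiv ℝ (fun ζ => fderiv ℝ f ζ v) x w = fderiv ℝ (fderiv ℝ f) x w v := by
    rw [fderiv_clm_apply hd (differentiableAt_const v)]
    simp
  rw [key, key]
  exact ((hf.contDiffAt (hV.mem_nhds hx)).isSymmSndFDerivAt
    (by rw [minSmoothness_of_isRCLikeNormedField]; exact ENat.LEInfty.out)).eq w v

lemma dZbar_dZ_comm {V : Set ℂ} (hV : IsOpen V) (hu : ContDiffOn ℝ ∞ u V) (hz : z ∈ V) :
    dZbar (dZ u) z = dZ (dZbar u) z := by
  have h1 := (contDiffOn_fderiv_apply hV hu 1).differentiableAt_of_isOpen hV hz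
  have h2 := (contDiffOn_fderiv_apply hV hu Complex.I).differentiableAt_of_isOpen hV hz
  have h2' : DifferentiableAt ℝ (fun ζ => Complex.I * fderiv ℝ u ζ Complex.I) z :=
    (differentiableAt_const _).mul h2
  have e1 : dZbar (dZ u) z = (1 / 2) * (dZbar (fun ζ => fderiv ℝ u ζ 1) z
      - Complex.I * dZbar (fun ζ => fderiv ℝ u ζ Complex.I) z) := by
    rw [← dZbar_const_mul _ h2, ← dZbar_sub h1 h2', ← dZbar_const_mul _ (h1.fun_sub h2')]
    rfl
  have e2 : dZ (dZbar u) z = (1 / 2) * (dZ (fun ζ => fderiv ℝ u ζ 1) z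
      + Complex.I * dZ (fun ζ => fderiv ℝ u ζ Complex.I) z) := by
    rw [← dZ_const_mul _ h2, ← dZ_add h1 h2', ← dZ_const_mul _ (h1.fun_add h2')]
    rfl
  rw [e1, e2]
  simp only [dZ, dZbar]
  rw [fderiv_fderiv_apply_comm hV hu hz Complex.I 1]
  ring

end Wirtinger

/-! ### Primitives on simply connected domains -/

/-- Local functions with locally constant differences glue, up to locally constant functions, on a
simply connected space. -/
theorem exists_glue_of_locally_const_sub {X A : Type*} [TopologicalSpace X]
    [SimplyConnectedSpace X] [LocallyPathConnectedSpace X] [AddCommGroup A]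
    (U : X → Set X) (hU : ∀ i, IsOpen (U i)) (hmem : ∀ i, i ∈ U i) (G : X → X → A)
    (hG : ∀ i j, ∀ x ∈ U i ∩ U j, ∀ᶠ y in nhds x, G i y - G j y = G i x - G j x) :
    ∃ g : X → A, ∀ i, ∀ᶠ x in nhds i, g x - G i x = g i - G i i := by
  -- The differences `G i - G j` are transition functions of a bundle with discrete fibre `A`. It is
  -- a covering, so over a simply connected base the identity lifts to a section `c`; read in the
  -- chart `i`, the section is `g - G i`, which is therefore locally constant.
  let _ : TopologicalSpace A := ⊥
  have : DiscreteTopology A := ⟨rfl⟩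
  let Z : FiberBundleCore X X A :=
    { baseSet := U
      isOpen_baseSet := hU
      indexAt := id
      mem_baseSet_at := hmem
      coordChange := fun i j x v => v + (G i x - G j x)
      coordChange_self := by simp
      continuousOn_coordChange := by
        rintro i j ⟨x, v⟩ ⟨hx, -⟩
        refine ContinuousAt.continuousWithinAt ?_
        have h : (fun p : X × A => p.2 + (G i p.1 - G j p.1)) =ᶠ[nhds (x, v)]
            fun p => p.2 + (G i x - G j x) := by
          filter_upwards [continuous_fst.continuousAt.eventually (hG i j x hx)] with p hp
          rw [hp]
        exact ContinuousAt.congr ((continuous_of_discreteTopology (f := fun a : A =>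
          a + (G i x - G j x))).comp continuous_snd).continuousAt h.symm
      coordChange_comp := by
        intro i j k x _ v
        abel }
  have cov : IsCoveringMap (Bundle.TotalSpace.proj : Bundle.TotalSpace A Z.Fiber → X) :=
    FiberBundle.isCoveringMap
  obtain ⟨x₀⟩ : Nonempty X := inferInstance
  obtain ⟨F, ⟨-, hF⟩, -⟩ := cov.existsUnique_continuousMap_lifts (ContinuousMap.id X) x₀
    (⟨x₀, (0 : A)⟩ : Bundle.TotalSpace A Z.Fiber) rfl
  have hF' (x : X) : (F x).1 = x := congrFun hF x
  let c (x : X) : A := (F x).2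
  refine ⟨fun x => c x + G x x, fun i => ?_⟩
  have hc : ContinuousAt (fun x => ((Z.localTriv i) (F x)).2) i := by
    refine continuous_snd.continuousAt.comp (ContinuousAt.comp ?_ F.continuous.continuousAt)
    refine (Z.localTriv i).continuousOn.continuousAt
      ((Z.localTriv i).open_source.mem_nhds ?_)
    rw [FiberBundleCore.mem_localTriv_source, hF']
    exact hmem i
  have hd := hc.eventually (isOpen_discrete {((Z.localTriv i) (F i)).2} |>.mem_nhds rfl)
  have val (x : X) : ((Z.localTriv i) (F x)).2 = c x + (G x x - G i x) := by
    rw [FiberBundleCore.localTriv_apply]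
    change c x + (G (F x).1 (F x).1 - G i (F x).1) = _
    rw [hF']
  filter_upwards [hd] with x hx
  have hx' : ((Z.localTriv i) (F x)).2 = ((Z.localTriv i) (F i)).2 := hx
  rw [val, val] at hx'
  rw [add_sub_assoc, hx', add_sub_assoc]

/-- A closed `1`-form on a simply connected open set is exact. -/
theorem exists_primitive_of_isSimplyConnected {E : Type*} [NormedAddCommGroup E] [NormedSpace ℝ E]
    {D : Set E} (hDo : IsOpen D) (hDs : IsSimplyConnected D) {θ : E → E →L[ℝ] ℝ}
    (hθ : DifferentiableOn ℝ θ D)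
    (hsymm : ∀ a ∈ D, ∀ x y, fderiv ℝ θ a x y = fderiv ℝ θ a y x) :
    ∃ f : E → ℝ, ∀ a ∈ D, HasFDerivAt f (θ a) a := by
  classical
  have := hDs.simplyConnectedSpace
  have := hDo.locallyPathConnectedSpace
  have hloc (i : D) : ∃ r > 0, Metric.ball (i : E) r ⊆ D ∧
      ∃ G : E → ℝ, ∀ a ∈ Metric.ball (i : E) r, HasFDerivAt G (θ a) a := by
    obtain ⟨r, hr, hrD⟩ := Metric.isOpen_iff.1 hDo i i.2
    exact ⟨r, hr, hrD, (convex_ball (i : E) r).exists_forall_hasFDerivAt_of_fderiv_symmetric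
      Metric.isOpen_ball (hθ.mono hrD) fun a ha => hsymm a (hrD ha)⟩
  choose r hr hrD G hG using hloc
  -- The primitives on two balls differ by a function with zero derivative on the overlap, hence
  -- locally constant there.
  obtain ⟨g, hg⟩ := exists_glue_of_locally_const_sub
    (fun i : D => (Subtype.val : D → E) ⁻¹' Metric.ball (i : E) (r i))
    (fun i => Metric.isOpen_ball.preimage continuous_subtype_val)
    (fun i => Metric.mem_ball_self (hr i)) (fun i x => G i x) (by
      rintro i j x ⟨hxi, hxj⟩
      obtain ⟨ε, hε, hεs⟩ := Metric.isOpen_iff.1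
        (Metric.isOpen_ball.inter (Metric.isOpen_ball (x := (j : E)) (ε := r j))) (x : E) ⟨hxi, hxj⟩
      have hev : ∀ᶠ y : D in nhds x, (y : E) ∈ Metric.ball (x : E) ε :=
        continuous_subtype_val.continuousAt.eventually (Metric.ball_mem_nhds _ hε)
      filter_upwards [hev] with y hy
      have hd (a : E) (ha : a ∈ Metric.ball (x : E) ε) :
          HasFDerivAt (fun a => G i a - G j a) (0 : E →L[ℝ] ℝ) a := by
        simpa using HasFDerivAt.fun_sub (hG i a (hεs ha).1) (hG j a (hεs ha).2)
      refine (convex_ball (x : E) ε).is_const_of_fderivWithin_eq_zero (𝕜 := ℝ)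
        (f := fun a => G i a - G j a) (fun a ha =>
        (hd a ha).differentiableAt.differentiableWithinAt) (fun a ha => ?_)
        hy (Metric.mem_ball_self hε)
      rw [fderivWithin_of_isOpen Metric.isOpen_ball ha, (hd a ha).fderiv])
  refine ⟨fun a => if ha : a ∈ D then g ⟨a, ha⟩ else 0, fun a ha => ?_⟩
  refine ((hG ⟨a, ha⟩ a (Metric.mem_ball_self (hr _))).add_const
    (g ⟨a, ha⟩ - G ⟨a, ha⟩ a)).congr_of_eventuallyEq ?_
  have h := hg ⟨a, ha⟩
  rw [nhds_subtype, Filter.eventually_comap] at h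
  filter_upwards [h, hDo.mem_nhds ha] with x hx hxD
  have := hx ⟨x, hxD⟩ rfl
  simp only [hxD, dite_true]
  rw [← this]
  ring

/-- The real `1`-form `2 Re (p dz)`. -/
noncomputable def reForm : ℂ →L[ℝ] ℂ →L[ℝ] ℝ :=
  LinearMap.toContinuousLinearMap
    { toFun := fun p => (2 : ℝ) • Complex.reCLM.comp (ContinuousLinearMap.mul ℝ ℂ p)
      map_add' := by intro p q; ext v; simp
      map_smul' := by intro c p; ext v; simp; ring }

@[simp] lemma reForm_apply (p v : ℂ) : reForm p v = 2 * (p * v).re := by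
  simp [reForm]

/-- On a simply connected open set, `u_z = P` has a smooth real solution `u` as soon as `P_z̄` is
real. -/
theorem exists_dZ_eq {D : Set ℂ} (hDo : IsOpen D) (hDs : IsSimplyConnected D) {P : ℂ → ℂ}
    (hP : ContDiffOn ℝ ∞ P D) (him : ∀ z ∈ D, (dZbar P z).im = 0) :
    ∃ x : ℂ → ℝ, ContDiffOn ℝ ∞ x D ∧ ∀ z ∈ D, dZ (fun ζ => (x ζ : ℂ)) z = P z := by
  -- For real `x`, `x_z = P` says `dx = 2 Re (P dz)`, and this form is closed exactly when `P_z̄` is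
  -- real.
  have hθ : ContDiffOn ℝ ∞ (fun z => reForm (P z)) D := reForm.contDiff.comp_contDiffOn hP
  obtain ⟨x, hx⟩ := exists_primitive_of_isSimplyConnected hDo hDs
    (θ := fun z => reForm (P z)) (hθ.differentiableOn (by simp)) (by
      intro a ha v w
      have hPa := hP.differentiableAt_of_isOpen hDo ha
      have hd : fderiv ℝ (fun z => reForm (P z)) a = reForm.comp (fderiv ℝ P a) :=
        (reForm.hasFDerivAt.comp a hPa.hasFDerivAt).fderiv
      have lin (v : ℂ) : fderiv ℝ P a v = v.re * fderiv ℝ P a 1 + v.im * fderiv ℝ P a Complex.I := by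
        conv_lhs => rw [show v = v.re • (1 : ℂ) + v.im • Complex.I by simp]
        rw [map_add, map_smul, map_smul, Complex.real_smul, Complex.real_smul]
      have h := him a ha
      simp [dZbar, Complex.mul_im] at h
      rw [hd, ContinuousLinearMap.comp_apply, ContinuousLinearMap.comp_apply, reForm_apply,
        reForm_apply, lin v, lin w]
      simp [Complex.mul_re, Complex.mul_im]
      linear_combination -(v.re * w.im - v.im * w.re) * h)
  have hfd (z : ℂ) (hz : z ∈ D) : fderiv ℝ x z = reForm (P z) := (hx z hz).fderiv
  refine ⟨x, ?_, fun z hz => ?_⟩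
  · refine contDiffOn_infty_iff_fderiv_of_isOpen hDo |>.2 ⟨fun z hz =>
      (hx z hz).differentiableAt.differentiableWithinAt, hθ.congr hfd⟩
  · have hd := (hx z hz).differentiableAt
    rw [dZ, fderiv_ofReal_apply hd, fderiv_ofReal_apply hd, hfd z hz]
    apply Complex.ext <;> simp

/-! ### Zeros and square roots of holomorphic functions -/

/-- The punctured disc is the image of a half-plane under a translated exponential. -/
lemma isPreconnected_ball_diff_singleton (z : ℂ) {r : ℝ} (hr : 0 < r) :
    IsPreconnected (Metric.ball z r \ {z}) := by
  have h : Metric.ball z r \ {z} = (fun w => z + Complex.exp w) '' {w | w.re < Real.log r} := by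
    ext w
    simp only [Set.mem_sdiff, Metric.mem_ball, Set.mem_singleton_iff, Set.mem_image,
      Set.mem_ofPred_eq]
    constructor
    · rintro ⟨hw, hne⟩
      have hne' : w - z ≠ 0 := sub_ne_zero.2 hne
      refine ⟨Complex.log (w - z), ?_, by rw [Complex.exp_log hne']; ring⟩
      rw [Complex.log_re, ← dist_eq_norm]
      exact Real.log_lt_log (dist_pos.2 hne) hw
    · rintro ⟨v, hv, rfl⟩
      refine ⟨?_, by simp⟩
      rw [dist_eq_norm, add_sub_cancel_left, Complex.norm_exp]
      exact (Real.lt_log_iff_exp_lt hr).1 hv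
  rw [h]
  exact (convex_halfSpace_re_lt _).isPreconnected.image _ (by fun_prop)

/-- A domain remains connected when the zeros of a nonzero holomorphic function are removed. -/
theorem isPreconnected_ne_zero {D : Set ℂ} (hDo : IsOpen D) (hDc : IsPreconnected D) {B : ℂ → ℂ}
    (hB : DifferentiableOn ℂ B D) (hne : ∃ z ∈ D, B z ≠ 0) :
    IsPreconnected {z | z ∈ D ∧ B z ≠ 0} := by
  set R := {z | z ∈ D ∧ B z ≠ 0}
  have hpunct (z : ℂ) (hz : z ∈ D) : ∀ᶠ w in nhdsWithin z {z}ᶜ, w ∈ R := by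
    have hD : ∀ᶠ w in nhdsWithin z {z}ᶜ, w ∈ D := nhdsWithin_le_nhds (hDo.mem_nhds hz)
    rcases (hB.analyticOnNhd hDo z hz).eventually_eq_zero_or_eventually_ne_zero with h | h
    · obtain ⟨w, hw, hBw⟩ := hne
      exact absurd ((hB.analyticOnNhd hDo).eqOn_zero_of_preconnected_of_eventuallyEq_zero hDc hz h
        hw) hBw
    · filter_upwards [h, hD] with w h1 h2 using ⟨h2, h1⟩
  have hopen (u : Set ℂ) (hu : IsOpen u) : IsOpen {z | ∀ᶠ w in nhdsWithin z {z}ᶜ, w ∈ u} := by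
    rw [isOpen_iff_mem_nhds]
    intro z hz
    rw [Set.mem_ofPred_eq, eventually_nhdsWithin_iff] at hz
    filter_upwards [hz.eventually_nhds] with w hw
    rcases eq_or_ne w z with rfl | hwz
    · exact eventually_nhdsWithin_iff.2 hw
    · exact nhdsWithin_le_nhds (hu.mem_nhds (hw.self_of_nhds hwz))
  intro u v hu hv huv ⟨a, haR, hau⟩ ⟨b, hbR, hbv⟩
  by_contra hempty
  -- Each of `u`, `v` is enlarged to the points that have a punctured neighbourhood inside it. If
  -- `u` and `v` were disjoint on `R`, every small punctured disc, being connected, would lie in one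
  -- of them; so the enlarged sets cover the connected `D` and must meet.
  have hcov : D ⊆ {z | ∀ᶠ w in nhdsWithin z {z}ᶜ, w ∈ u} ∪
      {z | ∀ᶠ w in nhdsWithin z {z}ᶜ, w ∈ v} := by
    intro z hz
    obtain ⟨ε, hε, hεR⟩ := Metric.mem_nhdsWithin_iff.1 (hpunct z hz)
    by_contra hcon
    simp only [Set.mem_union, Set.mem_ofPred_eq, not_or] at hcon
    obtain ⟨h1, h2⟩ := hcon
    have hmem : Metric.ball z ε \ {z} ∈ nhdsWithin z {z}ᶜ :=
      Metric.mem_nhdsWithin_iff.2 ⟨ε, hε, fun w hw => hw⟩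
    have hsub : Metric.ball z ε \ {z} ⊆ u ∪ v := fun w hw => huv (hεR hw)
    have hU : ((Metric.ball z ε \ {z}) ∩ u).Nonempty := by
      by_contra hemp
      refine h2 (Filter.mem_of_superset hmem fun w hw => (hsub hw).resolve_left fun hwu => ?_)
      exact hemp ⟨w, hw, hwu⟩
    have hV : ((Metric.ball z ε \ {z}) ∩ v).Nonempty := by
      by_contra hemp
      refine h1 (Filter.mem_of_superset hmem fun w hw => (hsub hw).resolve_right fun hwu => ?_)
      exact hemp ⟨w, hw, hwu⟩
    obtain ⟨c, hc, hcu, hcv⟩ := isPreconnected_ball_diff_singleton z hε u v hu hv hsub hU hV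
    exact hempty ⟨c, hεR hc, hcu, hcv⟩
  obtain ⟨z, hzD, hzu, hzv⟩ := hDc _ _ (hopen u hu) (hopen v hv) hcov
    ⟨a, haR.1, nhdsWithin_le_nhds (hu.mem_nhds hau)⟩
    ⟨b, hbR.1, nhdsWithin_le_nhds (hv.mem_nhds hbv)⟩
  rw [Set.mem_ofPred_eq] at hzu hzv
  obtain ⟨w, ⟨hwu, hwv⟩, hwR⟩ := ((hzu.and hzv).and (hpunct z hzD)).exists
  exact hempty ⟨w, hwR, hwu, hwv⟩

/-- A holomorphic function has a holomorphic square root of its opposite near a point where it does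
not vanish. -/
theorem exists_isSqrtBranch {R : Set ℂ} (hR : IsOpen R) {B : ℂ → ℂ} (hB : DifferentiableOn ℂ B R)
    {z₀ : ℂ} (hz₀ : z₀ ∈ R) (hne : B z₀ ≠ 0) :
    ∃ V ⊆ R, IsOpen V ∧ z₀ ∈ V ∧ ∃ s, IsSqrtBranch V B s := by
  -- Dividing by `B z₀` moves the value at `z₀` to `1`, inside the domain of the principal
  -- logarithm; `c` is a square root of the constant split off.
  obtain ⟨c, hc⟩ := IsAlgClosed.exists_pow_nat_eq (-B z₀) two_pos
  have hd : DifferentiableOn ℂ (fun z => B z / B z₀) R := hB.div_const _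
  refine ⟨R ∩ (fun z => B z / B z₀) ⁻¹' Complex.slitPlane, Set.inter_subset_left,
    hd.continuousOn.isOpen_inter_preimage hR Complex.isOpen_slitPlane,
    ⟨hz₀, by simp [hne]⟩,
    fun z => c * Complex.exp (Complex.log (B z / B z₀) / 2), ?_, ?_⟩
  · refine DifferentiableOn.const_mul (DifferentiableOn.cexp (DifferentiableOn.div_const
      (DifferentiableOn.clog (hd.mono Set.inter_subset_left) fun z hz => hz.2) _)) _
  · intro z hz
    have hz0 : B z / B z₀ ≠ 0 := Complex.slitPlane_ne_zero hz.2
    rw [mul_pow, ← Complex.exp_nat_mul, hc]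
    rw [show ((2 : ℕ) : ℂ) * (Complex.log (B z / B z₀) / 2) = Complex.log (B z / B z₀) by
      push_cast; ring, Complex.exp_log hz0]
    field_simp

/-! ### The structure equations of a surface -/

section Surface

variable {V : Set ℂ} {f : ℂ → Vec3} {z : ℂ}

lemma contDiffOn_coord (hf : ContDiffOn ℝ ∞ f V) (k : Fin 3) :
    ContDiffOn ℝ ∞ (fun ζ => f ζ k) V :=
  contDiffOn_pi.1 hf k

lemma fderiv_coord (hf : DifferentiableAt ℝ f z) (v : ℂ) (k : Fin 3) :
    fderiv ℝ f z v k = fderiv ℝ (fun ζ => f ζ k) z v := by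
  have h := (hasFDerivAt_pi'.1 hf.hasFDerivAt) k
  rw [h.fderiv]
  rfl

lemma leftDeriv_contDiffOn (hV : IsOpen V) (hf : ContDiffOn ℝ ∞ f V) (v : ℂ) :
    ContDiffOn ℝ ∞ (fun ζ => leftDeriv f ζ v) V := by
  have h := contDiffOn_fderiv_apply hV hf v
  have hk (k : Fin 3) := contDiffOn_coord hf k
  have hdk (k : Fin 3) := contDiffOn_coord h k
  refine contDiffOn_pi.2 fun k => ?_
  fin_cases k
  · exact hdk 0
  · exact hdk 1
  · exact (hdk 2).add (contDiffOn_const.mul (((hk 1).mul (hdk 0)).sub ((hk 0).mul (hdk 1))))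

lemma mcZ_contDiffOn (hV : IsOpen V) (hf : ContDiffOn ℝ ∞ f V) (k : Fin 3) :
    ContDiffOn ℝ ∞ (fun ζ => mcZ f ζ k) V := by
  have h (v : ℂ) := (contDiffOn_coord (leftDeriv_contDiffOn hV hf v) k).complex_ofReal
  exact contDiffOn_const.mul ((h 1).sub (contDiffOn_const.mul (h Complex.I)))

lemma leftDeriv_apply_eq (f : ℂ → Vec3) (z v : ℂ) (k : Fin 3) :
    leftDeriv f z v k = 2 * (mcZ f z k * v).re := by
  have lin : fderiv ℝ f z v = v.re • fderiv ℝ f z 1 + v.im • fderiv ℝ f z Complex.I := by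
    conv_lhs => rw [show v = v.re • (1 : ℂ) + v.im • Complex.I by simp]
    rw [map_add, map_smul, map_smul]
  have key : leftDeriv f z v k = v.re * leftDeriv f z 1 k + v.im * leftDeriv f z Complex.I k := by
    fin_cases k <;> simp [leftDeriv, maurerCartan, lin]
    ring
  rw [key, mcZ]
  simp [Complex.mul_re, Complex.mul_im]
  ring

lemma dZ_coord (hf : DifferentiableAt ℝ f z) (k : Fin 3) :
    dZ (fun ζ => (f ζ k : ℂ)) z =
      (1 / 2) * ((fderiv ℝ f z 1 k : ℂ) - Complex.I * (fderiv ℝ f z Complex.I k : ℂ)) := by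
  have h := (hasFDerivAt_pi'.1 hf.hasFDerivAt k).differentiableAt
  rw [dZ, fderiv_ofReal_apply h, fderiv_ofReal_apply h, fderiv_coord hf, fderiv_coord hf]

lemma mcZ_zero (hf : DifferentiableAt ℝ f z) : mcZ f z 0 = dZ (fun ζ => (f ζ 0 : ℂ)) z := by
  rw [dZ_coord hf]; rfl

lemma mcZ_one (hf : DifferentiableAt ℝ f z) : mcZ f z 1 = dZ (fun ζ => (f ζ 1 : ℂ)) z := by
  rw [dZ_coord hf]; rfl

lemma mcZ_two (hf : DifferentiableAt ℝ f z) : mcZ f z 2 = dZ (fun ζ => (f ζ 2 : ℂ)) z +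
    (1 / 2) * ((f z 1 : ℂ) * mcZ f z 0 - (f z 0 : ℂ) * mcZ f z 1) := by
  rw [dZ_coord hf]
  simp [mcZ, leftDeriv, maurerCartan]
  ring

/-- For real `x`, conjugation exchanges the two Wirtinger derivatives, and these commute; so `x_zz̄`
equals its own conjugate. -/
lemma dZbar_dZ_ofReal_im (hV : IsOpen V) {x : ℂ → ℝ} (hx : ContDiffOn ℝ ∞ x V) (hz : z ∈ V) :
    (dZbar (dZ fun ζ => (x ζ : ℂ)) z).im = 0 := by
  have hxc := hx.complex_ofReal
  have h1 := dZbar_dZ_comm hV hxc hz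
  have h2 : dZ (dZbar fun ζ => (x ζ : ℂ)) z = dZ (fun w => conj (dZ (fun ζ => (x ζ : ℂ)) w)) z :=
    dZ_congr_of_isOpen hV (fun w hw => dZbar_ofReal (hx.differentiableAt_of_isOpen hV hw)) hz
  rw [dZ_conj ((contDiffOn_dZ hV hxc).differentiableAt_of_isOpen hV hz)] at h2
  exact Complex.conj_eq_iff_im.1 (h2.symm.trans h1.symm)

/-- The integrability conditions of the Maurer-Cartan form. -/
theorem dZbar_mcZ_im (hV : IsOpen V) (hf : ContDiffOn ℝ ∞ f V) (hz : z ∈ V) :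
    (dZbar (fun ζ => mcZ f ζ 0) z).im = 0 ∧ (dZbar (fun ζ => mcZ f ζ 1) z).im = 0 ∧
      (dZbar (fun ζ => mcZ f ζ 2) z).im = (mcZ f z 0 * conj (mcZ f z 1)).im := by
  have hd {w} (hw : w ∈ V) := hf.differentiableAt_of_isOpen hV hw
  have hx (k : Fin 3) := contDiffOn_coord hf k
  have e0 := dZbar_congr_of_isOpen hV (fun w hw => mcZ_zero (hd hw)) hz
  have e1 := dZbar_congr_of_isOpen hV (fun w hw => mcZ_one (hd hw)) hz
  have i0 := dZbar_dZ_ofReal_im hV (hx 0) hz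
  have i1 := dZbar_dZ_ofReal_im hV (hx 1) hz
  have i2 := dZbar_dZ_ofReal_im hV (hx 2) hz
  have hr0 : (dZbar (fun ζ => mcZ f ζ 0) z).im = 0 := by rw [e0]; exact i0
  have hr1 : (dZbar (fun ζ => mcZ f ζ 1) z).im = 0 := by rw [e1]; exact i1
  refine ⟨hr0, hr1, ?_⟩
  have e2 := dZbar_congr_of_isOpen hV (fun w hw => mcZ_two (hd hw)) hz
  have d0 := (mcZ_contDiffOn hV hf 0).differentiableAt_of_isOpen hV hz
  have d1 := (mcZ_contDiffOn hV hf 1).differentiableAt_of_isOpen hV hz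
  have c (k : Fin 3) := ((hx k).complex_ofReal).differentiableAt_of_isOpen hV hz
  have D2 := (contDiffOn_dZ hV (hx 2).complex_ofReal).differentiableAt_of_isOpen hV hz
  have b (k : Fin 3) := dZbar_ofReal ((hx k).differentiableAt_of_isOpen hV hz)
  rw [e2, dZbar_add D2 (((c 1).fun_mul d0).fun_sub ((c 0).fun_mul d1) |>.const_mul _),
    dZbar_const_mul _ (((c 1).fun_mul d0).fun_sub ((c 0).fun_mul d1)),
    dZbar_sub ((c 1).fun_mul d0) ((c 0).fun_mul d1), dZbar_mul (c 1) d0, dZbar_mul (c 0) d1,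
    b 0, b 1, ← mcZ_zero (hd hz), ← mcZ_one (hd hz)]
  simp [Complex.mul_im, Complex.mul_re, hr0, hr1]
  simp [i2]
  ring

/-- The equations satisfied by the Maurer-Cartan form of a conformal harmonic map. -/
def IsHarmonicAt (f : ℂ → Vec3) (z : ℂ) : Prop :=
  dZbar (fun ζ => mcZ f ζ 0) z = ((mcZ f z 1 * conj (mcZ f z 2)).re : ℂ) ∧
  dZbar (fun ζ => mcZ f ζ 1) z = -((mcZ f z 0 * conj (mcZ f z 2)).re : ℂ) ∧
  dZbar (fun ζ => mcZ f ζ 2) z = Complex.I * ((mcZ f z 0 * conj (mcZ f z 1)).im : ℂ)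

/-- This is the flat part of the tension field: the two left derivatives are `2 Re φ` and `-2 Im φ`.
-/
lemma fderiv_leftDeriv_add (hV : IsOpen V) (hf : ContDiffOn ℝ ∞ f V) (hz : z ∈ V) (k : Fin 3) :
    fderiv ℝ (fun ζ => leftDeriv f ζ 1) z 1 k +
      fderiv ℝ (fun ζ => leftDeriv f ζ Complex.I) z Complex.I k =
      4 * (dZbar (fun ζ => mcZ f ζ k) z).re := by
  have h (v : ℂ) := leftDeriv_contDiffOn hV hf v
  have hd (v : ℂ) := (h v).differentiableAt_of_isOpen hV hz
  have hk (v : ℂ) := (contDiffOn_coord (h v) k).differentiableAt_of_isOpen hV hz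
  have hc (v : ℂ) := (hk v).complex_ofReal
  rw [fderiv_coord (hd 1), fderiv_coord (hd Complex.I)]
  have e : dZbar (fun ζ => mcZ f ζ k) z = (1 / 2) * (dZbar (fun ζ => (leftDeriv f ζ 1 k : ℂ)) z -
      Complex.I * dZbar (fun ζ => (leftDeriv f ζ Complex.I k : ℂ)) z) := by
    rw [← dZbar_const_mul _ (hc _), ← dZbar_sub (hc _) ((hc _).const_mul _),
      ← dZbar_const_mul _ ((hc _).fun_sub ((hc _).const_mul _))]
    rfl
  rw [e]
  simp only [dZbar, fderiv_ofReal_apply (hk _)]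
  simp
  ring

/-- The tension field `∇_{∂x} f_x + ∇_{∂y} f_y`, left-translated. -/
lemma tension_apply (hV : IsOpen V) (hf : ContDiffOn ℝ ∞ f V) (hz : z ∈ V) :
    covDeriv f z 1 1 + covDeriv f z Complex.I Complex.I =
      ![4 * ((dZbar (fun ζ => mcZ f ζ 0) z).re - (mcZ f z 1 * conj (mcZ f z 2)).re),
        4 * ((dZbar (fun ζ => mcZ f ζ 1) z).re + (mcZ f z 0 * conj (mcZ f z 2)).re),
        4 * (dZbar (fun ζ => mcZ f ζ 2) z).re] := by
  have h (k : Fin 3) := fderiv_leftDeriv_add hV hf hz k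
  have hX (k : Fin 3) := leftDeriv_apply_eq f z 1 k
  have hY (k : Fin 3) := leftDeriv_apply_eq f z Complex.I k
  funext k
  have split : (covDeriv f z 1 1 + covDeriv f z Complex.I Complex.I) k =
      4 * (dZbar (fun ζ => mcZ f ζ k) z).re + (nilConn (leftDeriv f z 1) (leftDeriv f z 1) k +
        nilConn (leftDeriv f z Complex.I) (leftDeriv f z Complex.I) k) := by
    rw [← h k]
    simp only [covDeriv, Pi.add_apply]
    ring
  rw [split]
  fin_cases k <;> simp [nilConn, hX, hY, Complex.mul_re] <;> ring

/-- The imaginary parts of the three equations are integrability conditions and hold for every map;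
the real parts are the components of the tension field. -/
lemma isHarmonicAt_iff (hV : IsOpen V) (hf : ContDiffOn ℝ ∞ f V) (hz : z ∈ V) :
    IsHarmonicAt f z ↔ covDeriv f z 1 1 + covDeriv f z Complex.I Complex.I = 0 := by
  obtain ⟨i0, i1, i2⟩ := dZbar_mcZ_im hV hf hz
  rw [tension_apply hV hf hz, IsHarmonicAt]
  constructor
  · rintro ⟨h0, h1, h2⟩
    rw [h0, h1, h2]
    funext k
    fin_cases k <;> simp
  · intro h
    have h0 := congrFun h 0
    have h1 := congrFun h 1
    have h2 := congrFun h 2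
    simp only [Matrix.cons_val_zero, Matrix.cons_val_one, Matrix.cons_val, Pi.zero_apply] at h0 h1 h2
    refine ⟨Complex.ext ?_ ?_, Complex.ext ?_ ?_, Complex.ext ?_ ?_⟩
    · rw [Complex.ofReal_re]; linarith
    · rw [Complex.ofReal_im]; exact i0
    · rw [Complex.neg_re, Complex.ofReal_re]; linarith
    · rw [Complex.neg_im, Complex.ofReal_im, i1, neg_zero]
    · simp; linarith
    · rw [i2, Complex.mul_im]; simp

/-- In conformal coordinates the mean curvature is the normal component of the tension field up to
the factor `-1/(2 e^u)`. -/
lemma meanCurvature_eq_zero_iff (hp : 0 < metricFactor f z)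
    (hc : firstForm f z Complex.I Complex.I = metricFactor f z ∧ firstForm f z 1 Complex.I = 0)
    (m : Vec3) : meanCurvature f m z = 0 ↔
      lor (covDeriv f z 1 1 + covDeriv f z Complex.I Complex.I) m = 0 := by
  have e : meanCurvature f m z =
      -(lor (covDeriv f z 1 1 + covDeriv f z Complex.I Complex.I) m) / (2 * metricFactor f z) := by
    have h1 : firstForm f z 1 1 = metricFactor f z := rfl
    rw [meanCurvature, hc.1, hc.2, h1]
    simp only [secondForm, lor, Pi.add_apply]
    field_simp
    ring
  rw [e, div_eq_zero_iff, neg_eq_zero, or_iff_left (by positivity)]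

end Surface

/-! ### Surfaces with generating spinors -/

section Spinors

variable {V : Set ℂ} {f : ℂ → Vec3} {p q : ℂ → ℂ} {z : ℂ}

lemma IsGeneratingSpinors.mono {W : Set ℂ} (h : IsGeneratingSpinors V f p q) (hW : W ⊆ V) :
    IsGeneratingSpinors W f p q :=
  ⟨h.smooth₁.mono hW, h.smooth₂.mono hW, fun z hz => h.phi₁ z (hW hz), fun z hz => h.phi₂ z (hW hz),
    fun z hz => h.phi₃ z (hW hz)⟩

lemma IsConformalMaximal.mono {W : Set ℂ} (h : IsConformalMaximal V f) (hW : W ⊆ V) :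
    IsConformalMaximal W f :=
  ⟨h.smooth.mono hW, fun z hz => h.spacelike z (hW hz), fun z hz => h.conformal z (hW hz),
    fun z hz => h.maximal z (hW hz)⟩

/-- Hence being spacelike amounts to `|ψ₁| ≠ |ψ₂|`, the form in which it is used below. -/
lemma IsGeneratingSpinors.metricFactor_eq (h : IsGeneratingSpinors V f p q) (hz : z ∈ V) :
    metricFactor f z = 4 * (‖p z‖ ^ 2 - ‖q z‖ ^ 2) ^ 2 := by
  simp only [metricFactor, firstForm, lor, leftDeriv_apply_eq, h.phi₁ z hz, h.phi₂ z hz,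
    h.phi₃ z hz, Complex.sq_norm, Complex.normSq_apply]
  simp [pow_two]
  ring

lemma firstForm_eq_of_conformal
    (hc : firstForm f z Complex.I Complex.I = metricFactor f z ∧ firstForm f z 1 Complex.I = 0)
    (v w : ℂ) : firstForm f z v w = metricFactor f z * (v * conj w).re := by
  obtain ⟨h1, h2⟩ := hc
  simp only [metricFactor, firstForm, lor, leftDeriv_apply_eq] at *
  simp [Complex.mul_re] at *
  linear_combination v.im * w.im * h1 + (v.re * w.im + v.im * w.re) * h2

lemma mcZ_lor_eq_zero {m : Vec3} (hm : ∀ v, lor (leftDeriv f z v) m = 0) :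
    mcZ f z 0 * m 0 + mcZ f z 1 * m 1 - mcZ f z 2 * m 2 = 0 := by
  have h1 := hm 1
  have h2 := hm Complex.I
  simp only [lor, leftDeriv_apply_eq] at h1 h2
  apply Complex.ext <;> simp [Complex.mul_re, Complex.mul_im] at * <;> linarith

/-- A vector orthogonal to the tangent plane is a multiple of `(-2 Im ψ₁ψ₂, 2 Re ψ₁ψ₂, |ψ|²)`. -/
lemma IsGeneratingSpinors.orthogonal (h : IsGeneratingSpinors V f p q) (hz : z ∈ V)
    (hpq : ‖p z‖ ^ 2 - ‖q z‖ ^ 2 ≠ 0) {m : Vec3}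
    (hm : mcZ f z 0 * m 0 + mcZ f z 1 * m 1 - mcZ f z 2 * m 2 = 0) :
    (‖p z‖ ^ 2 + ‖q z‖ ^ 2) * m 0 = -2 * (p z * q z).im * m 2 ∧
      (‖p z‖ ^ 2 + ‖q z‖ ^ 2) * m 1 = 2 * (p z * q z).re * m 2 := by
  rw [h.phi₁ z hz, h.phi₂ z hz, h.phi₃ z hz] at hm
  have hm' := congrArg conj hm
  simp only [map_add, map_sub, map_mul, map_pow, Complex.conj_conj, Complex.conj_ofReal,
    Complex.conj_I, map_ofNat, map_zero] at hm'
  have hp := Complex.mul_conj' (p z)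
  have hq := Complex.mul_conj' (q z)
  have hd : ((‖p z‖ : ℂ) ^ 2 - (‖q z‖ : ℂ) ^ 2) ≠ 0 := by exact_mod_cast hpq
  -- Orthogonality is a linear relation between `m₀ + i m₁`, its conjugate and `m₂`. Eliminating the
  -- conjugate by means of the conjugate relation leaves a common factor `|ψ₁|² - |ψ₂|²`.
  have key : ((‖p z‖ : ℂ) ^ 2 + (‖q z‖ : ℂ) ^ 2) * ((m 0 : ℂ) + Complex.I * m 1) =
      2 * Complex.I * (p z * q z) * m 2 := by
    apply mul_left_cancel₀ hd
    rw [← hp, ← hq]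
    linear_combination (-(q z) ^ 2) * hm - (p z) ^ 2 * hm'
  constructor
  · have := congrArg Complex.re key
    have e : ((‖p z‖ : ℂ) ^ 2 + (‖q z‖ : ℂ) ^ 2) = ((‖p z‖ ^ 2 + ‖q z‖ ^ 2 : ℝ) : ℂ) := by
      push_cast; ring
    rw [e, Complex.re_ofReal_mul] at this
    simp [Complex.mul_re, Complex.mul_im] at *
    linarith
  · have := congrArg Complex.im key
    have e : ((‖p z‖ : ℂ) ^ 2 + (‖q z‖ : ℂ) ^ 2) = ((‖p z‖ ^ 2 + ‖q z‖ ^ 2 : ℝ) : ℂ) := by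
      push_cast; ring
    rw [e, Complex.im_ofReal_mul] at this
    simp [Complex.mul_re, Complex.mul_im] at *
    linarith

lemma mul_re_sq_add_im_sq (x y : ℂ) :
    (x * y).re ^ 2 + (x * y).im ^ 2 = ‖x‖ ^ 2 * ‖y‖ ^ 2 := by
  rw [← mul_pow, ← norm_mul, Complex.sq_norm, Complex.normSq_apply]
  ring

lemma spinorNorm_pos {x y : ℂ} (hxy : ‖x‖ ^ 2 - ‖y‖ ^ 2 ≠ 0) : 0 < ‖x‖ ^ 2 + ‖y‖ ^ 2 := by
  rcases (by positivity : 0 ≤ ‖x‖ ^ 2 + ‖y‖ ^ 2).lt_or_eq with h | h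
  · exact h
  · exfalso
    have h1 := sq_nonneg ‖x‖
    have h2 := sq_nonneg ‖y‖
    exact hxy (by linarith)

/-- Orthogonality fixes the direction of `m`, so the normalisation `-1` fixes `m₂` up to sign. -/
lemma IsGeneratingSpinors.unitNormal_two (h : IsGeneratingSpinors V f p q) (hz : z ∈ V)
    (hpq : ‖p z‖ ^ 2 - ‖q z‖ ^ 2 ≠ 0) {m : Vec3} (hm : IsUnitNormalAt f z m) :
    (m 2 * (‖p z‖ ^ 2 - ‖q z‖ ^ 2)) ^ 2 = (‖p z‖ ^ 2 + ‖q z‖ ^ 2) ^ 2 := by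
  obtain ⟨h0, h1⟩ := h.orthogonal hz hpq (mcZ_lor_eq_zero hm.2)
  have hl := hm.1
  have hn := mul_re_sq_add_im_sq (p z) (q z)
  rw [lor] at hl
  set s := ‖p z‖ ^ 2 + ‖q z‖ ^ 2 with hs
  have e : (s * m 0) ^ 2 + (s * m 1) ^ 2 - (s * m 2) ^ 2 = -s ^ 2 := by linear_combination s ^ 2 * hl
  rw [h0, h1] at e
  have e2 : (‖p z‖ ^ 2 - ‖q z‖ ^ 2) ^ 2 = s ^ 2 - 4 * (‖p z‖ ^ 2 * ‖q z‖ ^ 2) := by rw [hs]; ring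
  rw [mul_pow, e2, ← hn]
  linear_combination -e

/-- Maximality is a statement about all unit normals; this explicit one lets it be applied. -/
lemma IsGeneratingSpinors.exists_unitNormal (h : IsGeneratingSpinors V f p q) (hz : z ∈ V)
    (hpq : ‖p z‖ ^ 2 - ‖q z‖ ^ 2 ≠ 0) :
    IsUnitNormalAt f z ((‖p z‖ ^ 2 - ‖q z‖ ^ 2)⁻¹ •
      ![-2 * (p z * q z).im, 2 * (p z * q z).re, ‖p z‖ ^ 2 + ‖q z‖ ^ 2]) := by
  have hn := mul_re_sq_add_im_sq (p z) (q z)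
  constructor
  · simp only [lor, Pi.smul_apply, smul_eq_mul, Matrix.cons_val_zero, Matrix.cons_val_one,
      Matrix.cons_val]
    field_simp
    linear_combination 4 * hn
  · intro v
    simp only [lor, Pi.smul_apply, smul_eq_mul, Matrix.cons_val_zero, Matrix.cons_val_one,
      Matrix.cons_val, leftDeriv_apply_eq, h.phi₁ z hz, h.phi₂ z hz, h.phi₃ z hz,
      Complex.sq_norm, Complex.normSq_apply]
    simp [pow_two]
    ring

lemma IsGeneratingSpinors.conformal (h : IsGeneratingSpinors V f p q) (hz : z ∈ V) :
    mcZ f z 0 ^ 2 + mcZ f z 1 ^ 2 - mcZ f z 2 ^ 2 = 0 := by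
  rw [h.phi₁ z hz, h.phi₂ z hz, h.phi₃ z hz]
  linear_combination ((conj (q z) ^ 2 + p z ^ 2) ^ 2 - 4 * p z ^ 2 * conj (q z) ^ 2) * Complex.I_sq

/-- The tension field of a conformal map is orthogonal to the tangent plane: differentiate `φ₁² +
φ₂² - φ₃² = 0` in `z̄` and insert the imaginary parts of `φ_z̄` known from integrability. -/
lemma mcZ_lor_tension (hV : IsOpen V) (hf : ContDiffOn ℝ ∞ f V)
    (hc : ∀ z ∈ V, mcZ f z 0 ^ 2 + mcZ f z 1 ^ 2 - mcZ f z 2 ^ 2 = 0) (hz : z ∈ V) :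
    mcZ f z 0 * (covDeriv f z 1 1 + covDeriv f z Complex.I Complex.I) 0 +
      mcZ f z 1 * (covDeriv f z 1 1 + covDeriv f z Complex.I Complex.I) 1 -
      mcZ f z 2 * (covDeriv f z 1 1 + covDeriv f z Complex.I Complex.I) 2 = 0 := by
  have d (k : Fin 3) := (mcZ_contDiffOn hV hf k).differentiableAt_of_isOpen hV hz
  obtain ⟨i0, i1, i2⟩ := dZbar_mcZ_im hV hf hz
  have hD := dZbar_congr_of_isOpen (v := fun _ => (0 : ℂ)) hV hc hz
  rw [dZbar_const, dZbar_sub (((d 0).fun_pow 2).fun_add ((d 1).fun_pow 2)) ((d 2).fun_pow 2),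
    dZbar_add ((d 0).fun_pow 2) ((d 1).fun_pow 2), dZbar_sq (d 0), dZbar_sq (d 1),
    dZbar_sq (d 2)] at hD
  rw [← Complex.re_add_im (dZbar (fun ζ => mcZ f ζ 0) z),
    ← Complex.re_add_im (dZbar (fun ζ => mcZ f ζ 1) z),
    ← Complex.re_add_im (dZbar (fun ζ => mcZ f ζ 2) z), i0, i1, i2] at hD
  rw [tension_apply hV hf hz]
  simp only [Matrix.cons_val_zero, Matrix.cons_val_one, Matrix.cons_val]
  push_cast
  rw [Complex.re_eq_add_conj (mcZ f z 1 * _), Complex.re_eq_add_conj (mcZ f z 0 * _)]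
  rw [Complex.im_eq_sub_conj] at hD
  simp only [map_mul, Complex.conj_conj] at hD ⊢
  field_simp at hD
  push_cast at hD
  linear_combination 2 * hD

lemma IsConformalMaximal.norm_ne (hf : IsConformalMaximal V f) (h : IsGeneratingSpinors V f p q)
    (hz : z ∈ V) : ‖p z‖ ^ 2 - ‖q z‖ ^ 2 ≠ 0 := by
  intro h0
  have := hf.spacelike z hz
  rw [h.metricFactor_eq hz, h0] at this
  simp at this

/-- By conformality the tension field is a multiple of the normal, and by maximality it is
orthogonal to the normal; as the normal is not null, it vanishes. -/
theorem IsConformalMaximal.isHarmonicAt (hV : IsOpen V) (hf : IsConformalMaximal V f)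
    (h : IsGeneratingSpinors V f p q) (hz : z ∈ V) : IsHarmonicAt f z := by
  have hpq := hf.norm_ne h hz
  rw [isHarmonicAt_iff hV hf.smooth hz]
  have ht := mcZ_lor_tension hV hf.smooth (fun w hw => h.conformal hw) hz
  have hn := h.exists_unitNormal hz hpq
  have hm := (meanCurvature_eq_zero_iff (hf.spacelike z hz) (hf.conformal z hz) _).1
    (hf.maximal z hz _ hn)
  set τ := covDeriv f z 1 1 + covDeriv f z Complex.I Complex.I
  obtain ⟨h0, h1⟩ := h.orthogonal hz hpq ht
  have hs := spinorNorm_pos hpq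
  simp only [lor, Pi.smul_apply, smul_eq_mul, Matrix.cons_val_zero, Matrix.cons_val_one,
      Matrix.cons_val] at hm
  field_simp at hm
  have hre := mul_re_sq_add_im_sq (p z) (q z)
  have e2 : (‖p z‖ ^ 2 - ‖q z‖ ^ 2) ^ 2 * τ 2 = 0 := by
    linear_combination (-(‖p z‖ ^ 2 + ‖q z‖ ^ 2)) * hm + (-2) * (p z * q z).im * h0
      + 2 * (p z * q z).re * h1 + 4 * τ 2 * hre
  have t2 : τ 2 = 0 := (mul_eq_zero.1 e2).resolve_left (pow_ne_zero 2 hpq)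
  rw [t2, mul_zero] at h0 h1
  have t0 : τ 0 = 0 := (mul_eq_zero.1 h0).resolve_left hs.ne'
  have t1 : τ 1 = 0 := (mul_eq_zero.1 h1).resolve_left hs.ne'
  funext k
  fin_cases k
  exacts [t0, t1, t2]

/-- The Dirac equation of a conformal harmonic immersion. -/
theorem IsGeneratingSpinors.dirac (hV : IsOpen V) (h : IsGeneratingSpinors V f p q) (hz : z ∈ V)
    (hpq : ‖p z‖ ^ 2 - ‖q z‖ ^ 2 ≠ 0) (hh : IsHarmonicAt f z) :
    dZ q z = (1 / 2) * (p z * conj (p z) + q z * conj (q z)) * p z ∧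
      dZbar p z = -(1 / 2) * (p z * conj (p z) + q z * conj (q z)) * q z := by
  obtain ⟨h0, h1, h2⟩ := hh
  have dp := h.smooth₁.differentiableAt_of_isOpen hV hz
  have dq := h.smooth₂.differentiableAt_of_isOpen hV hz
  have dq' := dq.complex_conj
  rw [dZbar_congr_of_isOpen hV h.phi₁ hz, dZbar_sub (dq'.fun_pow 2) (dp.fun_pow 2), dZbar_sq dq',
    dZbar_sq dp, dZbar_conj dq, h.phi₂ z hz, h.phi₃ z hz, Complex.re_eq_add_conj] at h0
  rw [dZbar_congr_of_isOpen hV h.phi₂ hz, dZbar_const_mul _ ((dq'.fun_pow 2).fun_add (dp.fun_pow 2)),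
    dZbar_add (dq'.fun_pow 2) (dp.fun_pow 2), dZbar_sq dq',
    dZbar_sq dp, dZbar_conj dq, h.phi₁ z hz, h.phi₃ z hz, Complex.re_eq_add_conj] at h1
  have e2 := dZbar_congr_of_isOpen hV h.phi₃ hz
  rw [dZbar_mul (dp.const_mul _) dq', dZbar_const_mul _ dp, dZbar_conj dq] at e2
  rw [e2, h.phi₁ z hz, h.phi₂ z hz, Complex.im_eq_sub_conj] at h2
  simp only [map_mul, map_add, map_sub, map_pow, map_neg, neg_neg, Complex.conj_conj, Complex.conj_I,
    map_ofNat] at h0 h1 h2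
  set x := p z
  set y := q z
  set A := conj (dZ q z)
  set C := dZbar p z
  have hI := Complex.I_sq
  -- Since `φ₁ - iφ₂`, `φ₁ + iφ₂`, `φ₃` are multiples of `ψ̄₂²`, `ψ₁²`, `ψ₁ψ̄₂`, the harmonic
  -- equations give the defects of the two Dirac equations multiplied by `ψ̄₂`, by `ψ₁`, and
  -- combined. As the spinors do not vanish together, both defects are zero.
  have k1 : conj y * (A - (1 / 2) * (x * conj x + y * conj y) * conj x) = 0 := by
    linear_combination (1 / 4) * h0 - Complex.I / 4 * h1 + (1 / 2) *
      (conj y * A - conj y * x * conj x ^ 2 - conj y ^ 2 * conj x * y + x * C) * hI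
  have k2 : x * (C + (1 / 2) * (x * conj x + y * conj y) * y) = 0 := by
    linear_combination (-1 / 4) * h0 - Complex.I / 4 * h1 + (1 / 2) *
      (x * C + x * y ^ 2 * conj y + x ^ 2 * conj x * y + conj y * A) * hI
  have k3 : x * (A - (1 / 2) * (x * conj x + y * conj y) * conj x) +
      conj y * (C + (1 / 2) * (x * conj x + y * conj y) * y) = 0 := by
    field_simp at h2
    linear_combination (1 / 4) * h2
  have fin : A - (1 / 2) * (x * conj x + y * conj y) * conj x = 0 ∧
      C + (1 / 2) * (x * conj x + y * conj y) * y = 0 := by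
    by_cases hx : x = 0
    · have hy : conj y ≠ 0 := by
        intro hy
        apply hpq
        rw [hx, (map_eq_zero conj).1 hy]
        simp
      have a1 := (mul_eq_zero.1 k1).resolve_left hy
      rw [a1, mul_zero, zero_add] at k3
      exact ⟨a1, (mul_eq_zero.1 k3).resolve_left hy⟩
    · have c1 := (mul_eq_zero.1 k2).resolve_left hx
      rw [c1, mul_zero, add_zero] at k3
      exact ⟨(mul_eq_zero.1 k3).resolve_left hx, c1⟩
  constructor
  · have := congrArg conj (sub_eq_zero.1 fin.1)
    simp only [A, map_mul, map_add, Complex.conj_conj, map_div₀, map_one, map_ofNat] at this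
    rw [this]; ring
  · linear_combination fin.2

end Spinors

/-! ### The Abresch-Rosenberg differential -/

section DiracPair

/-- The pair `a = conj ψ₂`, `b = ψ₁` solves the Dirac equation with potential `-(|ψ₁|² + |ψ₂|²)/2`. -/
structure IsDiracPair (V : Set ℂ) (a b : ℂ → ℂ) : Prop where
  smooth₁ : ContDiffOn ℝ ∞ a V
  smooth₂ : ContDiffOn ℝ ∞ b V
  eq₁ : ∀ z ∈ V, dZbar a z = (1 / 2) * (a z * conj (a z) + b z * conj (b z)) * conj (b z)
  eq₂ : ∀ z ∈ V, dZbar b z = -(1 / 2) * (a z * conj (a z) + b z * conj (b z)) * conj (a z)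

/-- Half the Wronskian of two functions with respect to `∂_z`. -/
noncomputable def halfWronskian (a b : ℂ → ℂ) (z : ℂ) : ℂ :=
  (1 / 2) * (b z * dZ a z - a z * dZ b z)

variable {V : Set ℂ} {a b : ℂ → ℂ} {z : ℂ}

lemma halfWronskian_contDiffOn (hV : IsOpen V) (ha : ContDiffOn ℝ ∞ a V)
    (hb : ContDiffOn ℝ ∞ b V) : ContDiffOn ℝ ∞ (halfWronskian a b) V :=
  contDiffOn_const.mul ((hb.mul (contDiffOn_dZ hV ha)).sub (ha.mul (contDiffOn_dZ hV hb)))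

namespace IsDiracPair

/-- The terms with `conj a_z̄` and `conj b_z̄` cancel by the Dirac equation. -/
lemma dZ_norm (h : IsDiracPair V a b) (hV : IsOpen V) (hz : z ∈ V) :
    dZ (fun w => a w * conj (a w) + b w * conj (b w)) z =
      dZ a z * conj (a z) + dZ b z * conj (b z) := by
  have da := h.smooth₁.differentiableAt_of_isOpen hV hz
  have db := h.smooth₂.differentiableAt_of_isOpen hV hz
  have da' := da.complex_conj
  have db' := db.complex_conj
  rw [dZ_add (da.fun_mul da') (db.fun_mul db'), dZ_mul da da', dZ_mul db db', dZ_conj da, dZ_conj db,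
    h.eq₁ z hz, h.eq₂ z hz]
  simp only [map_mul, map_add, map_neg, Complex.conj_conj, map_div₀, map_one, map_ofNat]
  ring

lemma dZbar_norm (h : IsDiracPair V a b) (hV : IsOpen V) (hz : z ∈ V) :
    dZbar (fun w => a w * conj (a w) + b w * conj (b w)) z =
      a z * conj (dZ a z) + b z * conj (dZ b z) := by
  have da := h.smooth₁.differentiableAt_of_isOpen hV hz
  have db := h.smooth₂.differentiableAt_of_isOpen hV hz
  have da' := da.complex_conj
  have db' := db.complex_conj
  rw [dZbar_add (da.fun_mul da') (db.fun_mul db'), dZbar_mul da da', dZbar_mul db db', dZbar_conj da,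
    dZbar_conj db, h.eq₁ z hz, h.eq₂ z hz]
  ring

/-- The Abresch-Rosenberg differential is holomorphic. -/
theorem dZbar_halfWronskian (h : IsDiracPair V a b) (hV : IsOpen V) (hz : z ∈ V) :
    dZbar (halfWronskian a b) z = 0 := by
  have da := h.smooth₁.differentiableAt_of_isOpen hV hz
  have db := h.smooth₂.differentiableAt_of_isOpen hV hz
  have da' := da.complex_conj
  have db' := db.complex_conj
  have dza := (contDiffOn_dZ hV h.smooth₁).differentiableAt_of_isOpen hV hz
  have dzb := (contDiffOn_dZ hV h.smooth₂).differentiableAt_of_isOpen hV hz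
  have dS := (da.fun_mul da').fun_add (db.fun_mul db')
  -- Exchanging the derivatives allows the Dirac equation to be inserted into the second-order
  -- terms.
  have ea : dZbar (dZ a) z = dZ (fun w => (1 / 2) * (a w * conj (a w) + b w * conj (b w)) *
      conj (b w)) z := by
    rw [dZbar_dZ_comm hV h.smooth₁ hz]
    exact dZ_congr_of_isOpen hV h.eq₁ hz
  have eb : dZbar (dZ b) z = dZ (fun w => -(1 / 2) * (a w * conj (a w) + b w * conj (b w)) *
      conj (a w)) z := by
    rw [dZbar_dZ_comm hV h.smooth₂ hz]
    exact dZ_congr_of_isOpen hV h.eq₂ hz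
  rw [dZ_mul (dS.const_mul _) db', dZ_const_mul _ dS, h.dZ_norm hV hz, dZ_conj db] at ea
  rw [dZ_mul (dS.const_mul _) da', dZ_const_mul _ dS, h.dZ_norm hV hz, dZ_conj da] at eb
  have e : dZbar (halfWronskian a b) z = (1 / 2) * ((dZbar b z * dZ a z + b z * dZbar (dZ a) z) -
      (dZbar a z * dZ b z + a z * dZbar (dZ b) z)) := by
    rw [← dZbar_mul db dza, ← dZbar_mul da dzb, ← dZbar_sub (db.fun_mul dza) (da.fun_mul dzb),
      ← dZbar_const_mul _ ((db.fun_mul dza).fun_sub (da.fun_mul dzb))]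
    rfl
  rw [e, ea, eb, h.eq₁ z hz, h.eq₂ z hz]
  simp only [map_mul, map_add, map_neg, Complex.conj_conj, map_div₀, map_one, map_ofNat]
  ring

lemma differentiableOn_halfWronskian (h : IsDiracPair V a b) (hV : IsOpen V) :
    DifferentiableOn ℂ (halfWronskian a b) V := fun _ hz =>
  (differentiableAt_of_dZbar_eq_zero ((halfWronskian_contDiffOn hV h.smooth₁
    h.smooth₂).differentiableAt_of_isOpen hV hz) (h.dZbar_halfWronskian hV hz)).differentiableWithinAt

end IsDiracPair

end DiracPair

/-! ### The Maurer-Cartan form of the dual surface -/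

section Dual

variable {V : Set ℂ} {z : ℂ}

/-- The normalised conjugates `α = ā / |·|²`, `β = b̄ / |·|²` of a Dirac pair. -/
lemma IsDiracPair.exists_normalised {a b : ℂ → ℂ} (h : IsDiracPair V a b) (hV : IsOpen V)
    (hne : ∀ z ∈ V, a z * conj (a z) + b z * conj (b z) ≠ 0) :
    ∃ α β : ℂ → ℂ, ContDiffOn ℝ ∞ α V ∧ ContDiffOn ℝ ∞ β V ∧
      (∀ z ∈ V, conj (a z) = (a z * conj (a z) + b z * conj (b z)) * α z ∧
        conj (b z) = (a z * conj (a z) + b z * conj (b z)) * β z) ∧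
      ∀ z ∈ V, dZbar α z = 2 * conj (halfWronskian a b z) *
          (α z * conj (α z) + β z * conj (β z)) * conj (β z) ∧
        dZbar β z = -2 * conj (halfWronskian a b z) *
          (α z * conj (α z) + β z * conj (β z)) * conj (α z) := by
  set S : ℂ → ℂ := fun z => a z * conj (a z) + b z * conj (b z) with hSdef
  have ha' := h.smooth₁.complex_conj
  have hb' := h.smooth₂.complex_conj
  have hS : ContDiffOn ℝ ∞ S V := (h.smooth₁.mul ha').add (h.smooth₂.mul hb')
  have sα : ContDiffOn ℝ ∞ (fun z => conj (a z) / S z) V := by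
    simp only [div_eq_mul_inv]; exact ha'.mul (hS.inv hne)
  have sβ : ContDiffOn ℝ ∞ (fun z => conj (b z) / S z) V := by
    simp only [div_eq_mul_inv]; exact hb'.mul (hS.inv hne)
  refine ⟨fun z => conj (a z) / S z, fun z => conj (b z) / S z, sα, sβ, fun z hz =>
    ⟨(mul_div_cancel₀ _ (hne z hz)).symm, (mul_div_cancel₀ _ (hne z hz)).symm⟩, fun z hz => ?_⟩
  have hSz : S z ≠ 0 := hne z hz
  have cS : conj (S z) = S z := by
    simp only [hSdef, map_add, map_mul, Complex.conj_conj]; ring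
  have da := h.smooth₁.differentiableAt_of_isOpen hV hz
  have db := h.smooth₂.differentiableAt_of_isOpen hV hz
  have dS := hS.differentiableAt_of_isOpen hV hz
  have dα := sα.differentiableAt_of_isOpen hV hz
  have dβ := sβ.differentiableAt_of_isOpen hV hz
  -- The derivative of `α` is read off from the product rule for `ā = S α`, and likewise for `β`.
  have e1 : dZbar (fun w => conj (a w)) z = dZbar (fun w => S w * (conj (a w) / S w)) z :=
    dZbar_congr_of_isOpen hV (fun w hw => (mul_div_cancel₀ _ (hne w hw)).symm) hz
  have e2 : dZbar (fun w => conj (b w)) z = dZbar (fun w => S w * (conj (b w) / S w)) z :=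
    dZbar_congr_of_isOpen hV (fun w hw => (mul_div_cancel₀ _ (hne w hw)).symm) hz
  rw [dZbar_mul dS dα, dZbar_conj da, h.dZbar_norm hV hz] at e1
  rw [dZbar_mul dS dβ, dZbar_conj db, h.dZbar_norm hV hz] at e2
  have hT : conj (a z) / S z * conj (conj (a z) / S z) + conj (b z) / S z * conj (conj (b z) / S z)
      = 1 / S z := by
    simp only [map_div₀, Complex.conj_conj, cS]
    field_simp
    simp only [hSdef]; ring
  have hW : conj (halfWronskian a b z) =
      (1 / 2) * (conj (b z) * conj (dZ a z) - conj (a z) * conj (dZ b z)) := by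
    simp only [halfWronskian, map_mul, map_sub, map_div₀, map_one, map_ofNat]
  rw [hT, hW]
  simp only [map_div₀, Complex.conj_conj, cS]
  have hSe : S z = a z * conj (a z) + b z * conj (b z) := rfl
  constructor
  · apply mul_left_cancel₀ hSz
    field_simp
    field_simp at e1
    linear_combination (-1 : ℂ) * e1 + conj (dZ a z) * hSe
  · apply mul_left_cancel₀ hSz
    field_simp
    field_simp at e2
    linear_combination (-1 : ℂ) * e2 + conj (dZ b z) * hSe

/-- The equations of a conformal harmonic map for the Maurer-Cartan form
`(4 W (α² - β²), -4 i W (α² + β²), -8 i W α β)`. -/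
lemma dual_harmonic_equations {α β W : ℂ → ℂ} (dα : DifferentiableAt ℝ α z)
    (dβ : DifferentiableAt ℝ β z) (dW : DifferentiableAt ℝ W z)
    (hα : dZbar α z = 2 * conj (W z) * (α z * conj (α z) + β z * conj (β z)) * conj (β z))
    (hβ : dZbar β z = -2 * conj (W z) * (α z * conj (α z) + β z * conj (β z)) * conj (α z))
    (hW : dZbar W z = 0) {P₀ P₁ P₂ : ℂ → ℂ}
    (h₀ : P₀ = fun w => 4 * (W w * (α w ^ 2 - β w ^ 2)))
    (h₁ : P₁ = fun w => -4 * Complex.I * (W w * (α w ^ 2 + β w ^ 2)))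
    (h₂ : P₂ = fun w => -8 * Complex.I * (W w * (α w * β w))) :
    dZbar P₀ z = ((P₁ z * conj (P₂ z)).re : ℂ) ∧ dZbar P₁ z = -((P₀ z * conj (P₂ z)).re : ℂ) ∧
      dZbar P₂ z = Complex.I * ((P₀ z * conj (P₁ z)).im : ℂ) := by
  subst h₀ h₁ h₂
  have hI := Complex.I_sq
  have dα2 := dα.fun_pow 2
  have dβ2 := dβ.fun_pow 2
  rw [dZbar_const_mul _ (dW.fun_mul (dα2.fun_sub dβ2)), dZbar_mul dW (dα2.fun_sub dβ2),
    dZbar_sub dα2 dβ2, dZbar_const_mul _ (dW.fun_mul (dα2.fun_add dβ2)),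
    dZbar_mul dW (dα2.fun_add dβ2), dZbar_add dα2 dβ2, dZbar_const_mul _ (dW.fun_mul (dα.fun_mul dβ)),
    dZbar_mul dW (dα.fun_mul dβ), dZbar_mul dα dβ, dZbar_sq dα, dZbar_sq dβ, hW, hα, hβ,
    Complex.re_eq_add_conj, Complex.re_eq_add_conj, Complex.im_eq_sub_conj]
  simp only [map_mul, map_add, map_sub, map_pow, map_neg, neg_neg, Complex.conj_conj, Complex.conj_I,
    map_ofNat]
  refine ⟨?_, ?_, ?_⟩
  · linear_combination (16 * W z * conj (W z) * (α z * conj (α z) + β z * conj (β z)) *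
      (α z * conj (β z) + β z * conj (α z))) * hI
  · ring
  · field_simp
    ring

/-- A form that satisfies the integrability conditions is the Maurer-Cartan form of a map. -/
theorem exists_mcZ_eq {D : Set ℂ} (hDo : IsOpen D) (hDs : IsSimplyConnected D)
    {P : Fin 3 → ℂ → ℂ} (hP : ∀ k, ContDiffOn ℝ ∞ (P k) D)
    (h0 : ∀ z ∈ D, (dZbar (P 0) z).im = 0) (h1 : ∀ z ∈ D, (dZbar (P 1) z).im = 0)
    (h2 : ∀ z ∈ D, (dZbar (P 2) z).im = (P 0 z * conj (P 1 z)).im) :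
    ∃ F : ℂ → Vec3, ContDiffOn ℝ ∞ F D ∧ ∀ z ∈ D, ∀ k, mcZ F z k = P k z := by
  obtain ⟨x, hx, hxP⟩ := exists_dZ_eq hDo hDs (hP 0) h0
  obtain ⟨y, hy, hyP⟩ := exists_dZ_eq hDo hDs (hP 1) h1
  have sx := hx.complex_ofReal
  have sy := hy.complex_ofReal
  have sq : ContDiffOn ℝ ∞ (fun w => (y w : ℂ) * P 0 w - (x w : ℂ) * P 1 w) D :=
    (sy.mul (hP 0)).sub (sx.mul (hP 1))
  -- The third coordinate has to satisfy `φ₃ = t_z + (y x_z - x y_z)/2`; the condition `h2` is what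
  -- makes the `z̄`-derivative of the remaining form real.
  obtain ⟨t, ht, htP⟩ := exists_dZ_eq hDo hDs
    (P := fun w => P 2 w - (1 / 2) * ((y w : ℂ) * P 0 w - (x w : ℂ) * P 1 w))
    ((hP 2).sub (contDiffOn_const.mul sq)) (by
      intro z hz
      have d (k : Fin 3) := (hP k).differentiableAt_of_isOpen hDo hz
      have dx := sx.differentiableAt_of_isOpen hDo hz
      have dy := sy.differentiableAt_of_isOpen hDo hz
      have dq := sq.differentiableAt_of_isOpen hDo hz
      rw [dZbar_sub (d 2) (dq.const_mul _), dZbar_const_mul _ dq,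
        dZbar_sub (dy.fun_mul (d 0)) (dx.fun_mul (d 1)), dZbar_mul dy (d 0), dZbar_mul dx (d 1),
        dZbar_ofReal (hx.differentiableAt_of_isOpen hDo hz),
        dZbar_ofReal (hy.differentiableAt_of_isOpen hDo hz), hxP z hz, hyP z hz]
      simp [Complex.mul_im, Complex.mul_re, h0 z hz, h1 z hz, h2 z hz]
      ring)
  have hF : ContDiffOn ℝ ∞ (fun w => (![x w, y w, t w] : Vec3)) D := by
    refine contDiffOn_pi.2 fun k => ?_
    fin_cases k
    exacts [hx, hy, ht]
  refine ⟨fun w => ![x w, y w, t w], hF, fun z hz k => ?_⟩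
  have hd := hF.differentiableAt_of_isOpen hDo hz
  have m0 : mcZ (fun w => (![x w, y w, t w] : Vec3)) z 0 = P 0 z := by
    rw [mcZ_zero hd]; exact hxP z hz
  have m1 : mcZ (fun w => (![x w, y w, t w] : Vec3)) z 1 = P 1 z := by
    rw [mcZ_one hd]; exact hyP z hz
  fin_cases k
  · exact m0
  · exact m1
  · change mcZ (fun w => (![x w, y w, t w] : Vec3)) z 2 = P 2 z
    rw [mcZ_two hd, m0, m1]
    have := htP z hz
    simp only [Matrix.cons_val_zero, Matrix.cons_val_one, Matrix.cons_val]
    rw [this]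
    ring

end Dual

/-! ### Support function, Abresch-Rosenberg differential and unit normal in terms of spinors. -/

section SpinorConsequences

variable {V : Set ℂ} {f n : ℂ → Vec3} {p q : ℂ → ℂ} {z : ℂ}

lemma IsConformalMaximal.dirac (hV : IsOpen V) (hf : IsConformalMaximal V f)
    (h : IsGeneratingSpinors V f p q) (hz : z ∈ V) :
    dZ q z = (1 / 2) * (p z * conj (p z) + q z * conj (q z)) * p z ∧
      dZbar p z = -(1 / 2) * (p z * conj (p z) + q z * conj (q z)) * q z :=
  h.dirac hV hz (hf.norm_ne h hz) (hf.isHarmonicAt hV h hz)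

lemma IsConformalMaximal.isDiracPair (hV : IsOpen V) (hf : IsConformalMaximal V f)
    (h : IsGeneratingSpinors V f p q) : IsDiracPair V (fun ζ => conj (q ζ)) p where
  smooth₁ := h.smooth₂.complex_conj
  smooth₂ := h.smooth₁
  eq₁ z hz := by
    rw [dZbar_conj (h.smooth₂.differentiableAt_of_isOpen hV hz), (hf.dirac hV h hz).1]
    simp only [map_mul, map_add, Complex.conj_conj, map_div₀, map_one, map_ofNat]
    ring
  eq₂ z hz := by
    rw [(hf.dirac hV h hz).2, Complex.conj_conj]
    ring

lemma supportFn_eq (f n : ℂ → Vec3) (z : ℂ) :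
    supportFn f n z = -(Real.sqrt (metricFactor f z) * n z 2) := by
  simp [supportFn, lor]

/-- The factor `|ψ₁|² - |ψ₂|²` in `e^{u/2}` cancels the denominator of the third component of the
normal; squaring removes the choice of sign. -/
lemma IsConformalMaximal.supportFn_sq (hf : IsConformalMaximal V f)
    (h : IsGeneratingSpinors V f p q) (hz : z ∈ V) (hn : IsUnitNormalAt f z (n z)) :
    supportFn f n z ^ 2 = 4 * (‖p z‖ ^ 2 + ‖q z‖ ^ 2) ^ 2 := by
  have h1 := h.unitNormal_two hz (hf.norm_ne h hz) hn
  rw [supportFn_eq, neg_sq, mul_pow, Real.sq_sqrt (hf.spacelike z hz).le, h.metricFactor_eq hz, ← h1]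
  ring

lemma IsConformalMaximal.abs_supportFn (hf : IsConformalMaximal V f)
    (h : IsGeneratingSpinors V f p q) (hz : z ∈ V) (hn : IsUnitNormalAt f z (n z)) :
    |supportFn f n z| = 2 * (‖p z‖ ^ 2 + ‖q z‖ ^ 2) := by
  rw [← abs_of_nonneg (show 0 ≤ 2 * (‖p z‖ ^ 2 + ‖q z‖ ^ 2) by positivity), ← sq_eq_sq_iff_abs_eq_abs,
    hf.supportFn_sq h hz hn]
  ring

lemma IsConformalMaximal.supportFn_ne_zero (hf : IsConformalMaximal V f)
    (h : IsGeneratingSpinors V f p q) (hz : z ∈ V) (hn : IsUnitNormalAt f z (n z)) :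
    supportFn f n z ≠ 0 := by
  have := spinorNorm_pos (hf.norm_ne h hz)
  rw [← abs_pos, hf.abs_supportFn h hz hn]
  linarith

lemma IsConformalMaximal.supportFn_contDiffOn (hV : IsOpen V) (hf : IsConformalMaximal V f)
    (hn : ContDiffOn ℝ ∞ n V) : ContDiffOn ℝ ∞ (supportFn f n) V := by
  have hk (k : Fin 3) := contDiffOn_coord (leftDeriv_contDiffOn hV hf.smooth 1) k
  have hm : ContDiffOn ℝ ∞ (metricFactor f) V :=
    (((hk 0).mul (hk 0)).add ((hk 1).mul (hk 1))).sub ((hk 2).mul (hk 2))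
  have hs : ContDiffOn ℝ ∞ (fun z => -(Real.sqrt (metricFactor f z) * n z 2)) V :=
    ((hm.sqrt fun z hz => (hf.spacelike z hz).ne').mul (contDiffOn_coord hn 2)).neg
  exact hs.congr fun z _ => supportFn_eq f n z

lemma IsGeneratingSpinors.sq_eq (h : IsGeneratingSpinors V f p q) (hz : z ∈ V) :
    conj (q z) ^ 2 = (1 / 2) * (mcZ f z 0 - Complex.I * mcZ f z 1) ∧
      p z ^ 2 = -(1 / 2) * (mcZ f z 0 + Complex.I * mcZ f z 1) ∧
      p z * conj (q z) = -(1 / 2) * (Complex.I * mcZ f z 2) := by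
  rw [h.phi₁ z hz, h.phi₂ z hz, h.phi₃ z hz]
  refine ⟨?_, ?_, ?_⟩
  · linear_combination (1 / 2) * (conj (q z) ^ 2 + p z ^ 2) * Complex.I_sq
  · linear_combination (1 / 2) * (conj (q z) ^ 2 + p z ^ 2) * Complex.I_sq
  · linear_combination p z * conj (q z) * Complex.I_sq

/-- The Abresch-Rosenberg differential does not depend on the generating spinors. -/
theorem abreschRosenberg_congr {p' q' : ℂ → ℂ} (hV : IsOpen V) (h : IsGeneratingSpinors V f p q)
    (h' : IsGeneratingSpinors V f p' q') (hz : z ∈ V) (hne : p z ≠ 0 ∨ q z ≠ 0) :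
    abreschRosenberg p q z = abreschRosenberg p' q' z := by
  set P : ℂ → ℂ := fun z => (1 / 2) * (mcZ f z 0 - Complex.I * mcZ f z 1) with hP
  set Q : ℂ → ℂ := fun z => -(1 / 2) * (mcZ f z 0 + Complex.I * mcZ f z 1) with hQ
  set T : ℂ → ℂ := fun z => -(1 / 2) * (Complex.I * mcZ f z 2) with hT
  -- The products `ψ̄₂²`, `ψ₁²`, `ψ₁ψ̄₂` are determined by `f`, and their Wronskians are multiples
  -- of `B`; thus the sign ambiguity of the spinors never has to be tracked.
  have key {p q : ℂ → ℂ} (h : IsGeneratingSpinors V f p q) :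
      P z * abreschRosenberg p q z = (1 / 2) * (dZ P z * T z - P z * dZ T z) ∧
      Q z * abreschRosenberg p q z = (1 / 2) * (dZ T z * Q z - T z * dZ Q z) := by
    have dp := h.smooth₁.differentiableAt_of_isOpen hV hz
    have dq := (h.smooth₂.differentiableAt_of_isOpen hV hz).complex_conj
    have eP := dZ_congr_of_isOpen hV (fun w hw => (h.sq_eq hw).1) hz
    have eQ := dZ_congr_of_isOpen hV (fun w hw => (h.sq_eq hw).2.1) hz
    have eT := dZ_congr_of_isOpen hV (fun w hw => (h.sq_eq hw).2.2) hz
    rw [dZ_sq dq] at eP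
    rw [dZ_sq dp] at eQ
    rw [dZ_mul dp dq] at eT
    have vP : P z = conj (q z) ^ 2 := (h.sq_eq hz).1.symm
    have vQ : Q z = p z ^ 2 := (h.sq_eq hz).2.1.symm
    have vT : T z = p z * conj (q z) := (h.sq_eq hz).2.2.symm
    rw [vP, vQ, vT, ← eP, ← eQ, ← eT, abreschRosenberg]
    constructor <;> ring
  rcases hne with hp | hq
  · have hQ0 : Q z ≠ 0 := by
      rw [show Q z = p z ^ 2 from (h.sq_eq hz).2.1.symm]; exact pow_ne_zero 2 hp
    exact mul_left_cancel₀ hQ0 ((key h).2.trans (key h').2.symm)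
  · have hP0 : P z ≠ 0 := by
      rw [show P z = conj (q z) ^ 2 from (h.sq_eq hz).1.symm]
      exact pow_ne_zero 2 ((map_ne_zero conj).2 hq)
    exact mul_left_cancel₀ hP0 ((key h).1.trans (key h').1.symm)

lemma IsConformalMaximal.spinor_ne_zero (hf : IsConformalMaximal V f)
    (h : IsGeneratingSpinors V f p q) (hz : z ∈ V) : p z ≠ 0 ∨ q z ≠ 0 := by
  by_contra hcon
  push Not at hcon
  exact hf.norm_ne h hz (by simp [hcon])

lemma IsGeneratingSpinors.unitNormal_eq_or (h : IsGeneratingSpinors V f p q) (hz : z ∈ V)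
    (hpq : ‖p z‖ ^ 2 - ‖q z‖ ^ 2 ≠ 0) {m m' : Vec3} (hm : IsUnitNormalAt f z m)
    (hm' : IsUnitNormalAt f z m') : m 2 ≠ 0 ∧ (m' = m ∨ m' = -m) := by
  have hs := (spinorNorm_pos hpq).ne'
  have e := h.unitNormal_two hz hpq hm
  have e' := h.unitNormal_two hz hpq hm'
  obtain ⟨a0, a1⟩ := h.orthogonal hz hpq (mcZ_lor_eq_zero hm.2)
  obtain ⟨b0, b1⟩ := h.orthogonal hz hpq (mcZ_lor_eq_zero hm'.2)
  refine ⟨fun h0 => ?_, ?_⟩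
  · rw [h0, zero_mul, zero_pow two_ne_zero] at e
    exact hs (pow_eq_zero_iff two_ne_zero |>.1 e.symm)
  · rw [← e, mul_pow, mul_pow] at e'
    rcases sq_eq_sq_iff_eq_or_eq_neg.1 (mul_right_cancel₀ (pow_ne_zero 2 hpq) e') with h2 | h2
    · left
      rw [h2, ← a0] at b0
      rw [h2, ← a1] at b1
      funext k
      fin_cases k
      exacts [mul_left_cancel₀ hs b0, mul_left_cancel₀ hs b1, h2]
    · right
      rw [h2, mul_neg, ← a0, ← mul_neg] at b0
      rw [h2, mul_neg, ← a1, ← mul_neg] at b1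
      funext k
      fin_cases k
      exacts [mul_left_cancel₀ hs b0, mul_left_cancel₀ hs b1, h2]

end SpinorConsequences

/-! ### Pointwise geometry of the dual surface -/

section DualPointwise

variable {f F : ℂ → Vec3} {z l : ℂ}

/-- At a point, the two differentials differ by the antilinear map `v ↦ conj (l v)` of the parameter
plane. All pointwise geometry of the dual surface follows from this. -/
lemma leftDeriv_dual (hF : ∀ k, mcZ F z k = l * conj (mcZ f z k)) (v : ℂ) :
    leftDeriv F z v = leftDeriv f z (conj (l * v)) := by
  funext k
  rw [leftDeriv_apply_eq, leftDeriv_apply_eq, hF]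
  simp [Complex.mul_re, Complex.mul_im]
  ring

lemma firstForm_dual (hF : ∀ k, mcZ F z k = l * conj (mcZ f z k))
    (hc : firstForm f z Complex.I Complex.I = metricFactor f z ∧ firstForm f z 1 Complex.I = 0)
    (v w : ℂ) : firstForm F z v w = ‖l‖ ^ 2 * metricFactor f z * (v * conj w).re := by
  have h : firstForm F z v w = firstForm f z (conj (l * v)) (conj (l * w)) := by
    rw [firstForm, leftDeriv_dual hF, leftDeriv_dual hF, firstForm]
  rw [h, firstForm_eq_of_conformal hc, Complex.sq_norm, Complex.normSq_apply]
  simp [Complex.mul_re, Complex.mul_im]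
  ring

lemma metricFactor_dual (hF : ∀ k, mcZ F z k = l * conj (mcZ f z k))
    (hc : firstForm f z Complex.I Complex.I = metricFactor f z ∧ firstForm f z 1 Complex.I = 0) :
    metricFactor F z = ‖l‖ ^ 2 * metricFactor f z := by
  rw [metricFactor, firstForm_dual hF hc]
  simp

lemma conformal_dual (hF : ∀ k, mcZ F z k = l * conj (mcZ f z k))
    (hc : firstForm f z Complex.I Complex.I = metricFactor f z ∧ firstForm f z 1 Complex.I = 0) :
    firstForm F z Complex.I Complex.I = metricFactor F z ∧ firstForm F z 1 Complex.I = 0 := by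
  rw [metricFactor_dual hF hc, firstForm_dual hF hc, firstForm_dual hF hc]
  simp

lemma isUnitNormalAt_dual (hF : ∀ k, mcZ F z k = l * conj (mcZ f z k)) (hl : l ≠ 0) (m : Vec3) :
    IsUnitNormalAt F z m ↔ IsUnitNormalAt f z m := by
  refine and_congr_right fun _ => ⟨fun h v => ?_, fun h v => ?_⟩
  · have := h (conj v / l)
    rwa [leftDeriv_dual hF, mul_div_cancel₀ _ hl, Complex.conj_conj] at this
  · rw [leftDeriv_dual hF]
    exact h _

/-- A real relation between the two parts gives a vector killed by the differential of `f`, hence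
zero since the metric is positive. `Φ` need not be a Maurer-Cartan form: at a branch point it is the
leading coefficient. -/
lemma linearIndependent_dual {Φ : Fin 3 → ℂ} (hΦ : ∀ k, Φ k = l * conj (mcZ f z k)) (hl : l ≠ 0)
    (hp : 0 < metricFactor f z)
    (hc : firstForm f z Complex.I Complex.I = metricFactor f z ∧ firstForm f z 1 Complex.I = 0) :
    LinearIndependent ℝ ![fun i => (Φ i).re, fun i => (Φ i).im] := by
  rw [LinearIndependent.pair_iff]
  intro s t hst
  set v : ℂ := conj (l * (s - Complex.I * t)) with hv
  have h0 : leftDeriv f z v = 0 := by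
    funext k
    have hk := congrFun hst k
    rw [leftDeriv_apply_eq, hv]
    simp [hΦ, Complex.mul_re, Complex.mul_im] at hk ⊢
    linarith
  have h1 := firstForm_eq_of_conformal hc v v
  rw [firstForm, h0] at h1
  have h2 : (v * conj v).re = 0 := by
    have : metricFactor f z * (v * conj v).re = 0 := by rw [← h1]; simp [lor]
    exact (mul_eq_zero.1 this).resolve_left hp.ne'
  rw [Complex.mul_conj, Complex.ofReal_re, Complex.normSq_eq_zero, hv, map_eq_zero, mul_eq_zero] at h2
  have h3 := h2.resolve_left hl
  have hre := congrArg Complex.re h3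
  have him := congrArg Complex.im h3
  simp at hre him
  exact ⟨hre, him⟩

end DualPointwise

/-! ### Left translations -/

section Translation

/-- The linear part of the left translation by `p`. -/
noncomputable def nilMulLinear (p : Vec3) : Vec3 →L[ℝ] Vec3 :=
  LinearMap.toContinuousLinearMap
    { toFun := fun v => ![v 0, v 1, v 2 + (1 / 2) * (p 0 * v 1 - v 0 * p 1)]
      map_add' := by intro v w; funext k; fin_cases k <;> simp; ring
      map_smul' := by intro c v; funext k; fin_cases k <;> simp; ring }

lemma nilMul_eq (p : Vec3) : nilMul p = fun x => p + nilMulLinear p x := by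
  funext x k
  fin_cases k <;> simp [nilMul, nilMulLinear]
  ring

lemma isRigidMotion_nilMul (p : Vec3) : IsRigidMotion (nilMul p) := by
  have hfd (x : Vec3) : fderiv ℝ (nilMul p) x = nilMulLinear p := by
    rw [nilMul_eq]
    exact ((nilMulLinear p).hasFDerivAt.const_add p).fderiv
  refine ⟨?_, ⟨fun x y hxy => ?_, fun y => ⟨![y 0 - p 0, y 1 - p 1,
    y 2 - p 2 - (1 / 2) * (p 0 * (y 1 - p 1) - (y 0 - p 0) * p 1)], ?_⟩⟩, fun x v w => ?_⟩
  · rw [nilMul_eq]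
    exact contDiff_const.add (nilMulLinear p).contDiff
  · have h0 : x 0 = y 0 := by simpa [nilMul] using congrFun hxy 0
    have h1 : x 1 = y 1 := by simpa [nilMul] using congrFun hxy 1
    have h2 : x 2 = y 2 := by simpa [nilMul, h0, h1] using congrFun hxy 2
    funext k
    fin_cases k
    exacts [h0, h1, h2]
  · funext k
    fin_cases k <;> simp [nilMul]
    ring
  · rw [hfd]
    simp [nilMetric, maurerCartan, lor, nilMul, nilMulLinear]
    ring

/-- Maps of a domain with the same Maurer-Cartan form differ by a left translation. -/
theorem exists_eq_nilMul {R : Set ℂ} (hR : IsOpen R) (hRc : IsPreconnected R) {f F : ℂ → Vec3}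
    (hf : ContDiffOn ℝ ∞ f R) (hF : ContDiffOn ℝ ∞ F R)
    (h : ∀ z ∈ R, ∀ k, mcZ F z k = mcZ f z k) : ∃ p : Vec3, ∀ z ∈ R, F z = nilMul p (f z) := by
  have hl (z : ℂ) (hz : z ∈ R) (v : ℂ) : leftDeriv F z v = leftDeriv f z v := by
    funext k
    rw [leftDeriv_apply_eq, leftDeriv_apply_eq, h z hz]
  have df {z : ℂ} (hz : z ∈ R) := hf.differentiableAt_of_isOpen hR hz
  have dF {z : ℂ} (hz : z ∈ R) := hF.differentiableAt_of_isOpen hR hz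
  have dfk {z : ℂ} (hz : z ∈ R) (k : Fin 3) :=
    (contDiffOn_coord hf k).differentiableAt_of_isOpen hR hz
  have dFk {z : ℂ} (hz : z ∈ R) (k : Fin 3) :=
    (contDiffOn_coord hF k).differentiableAt_of_isOpen hR hz
  have e0 {z : ℂ} (hz : z ∈ R) (v : ℂ) : fderiv ℝ (fun w => F w 0) z v =
      fderiv ℝ (fun w => f w 0) z v := by
    rw [← fderiv_coord (df hz), ← fderiv_coord (dF hz)]
    exact congrFun (hl z hz v) 0
  have e1 {z : ℂ} (hz : z ∈ R) (v : ℂ) : fderiv ℝ (fun w => F w 1) z v =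
      fderiv ℝ (fun w => f w 1) z v := by
    rw [← fderiv_coord (df hz), ← fderiv_coord (dF hz)]
    exact congrFun (hl z hz v) 1
  obtain ⟨c0, hc0⟩ := hR.exists_eq_add_of_fderiv_eq (𝕜 := ℝ) hRc
    ((contDiffOn_coord hF 0).differentiableOn (by simp))
    ((contDiffOn_coord hf 0).differentiableOn (by simp))
    (fun z hz => ContinuousLinearMap.ext (e0 hz))
  obtain ⟨c1, hc1⟩ := hR.exists_eq_add_of_fderiv_eq (𝕜 := ℝ) hRc
    ((contDiffOn_coord hF 1).differentiableOn (by simp))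
    ((contDiffOn_coord hf 1).differentiableOn (by simp))
    (fun z hz => ContinuousLinearMap.ext (e1 hz))
  -- Once the first two coordinates differ by constants, the group law predicts this third
  -- coordinate up to a constant.
  have dg {z : ℂ} (hz : z ∈ R) : HasFDerivAt (fun w => f w 2 + (1 / 2) * (c0 * f w 1 - f w 0 * c1))
      (fderiv ℝ (fun w => f w 2) z + (1 / 2 : ℝ) • (c0 • fderiv ℝ (fun w => f w 1) z -
        c1 • fderiv ℝ (fun w => f w 0) z)) z := by
    refine (dfk hz 2).hasFDerivAt.fun_add (HasFDerivAt.const_mul (HasFDerivAt.fun_sub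
      ((dfk hz 1).hasFDerivAt.const_mul c0) ?_) _)
    exact (dfk hz 0).hasFDerivAt.mul_const c1
  obtain ⟨c2, hc2⟩ := hR.exists_eq_add_of_fderiv_eq (𝕜 := ℝ) hRc
    ((contDiffOn_coord hF 2).differentiableOn (by simp))
    (fun z hz => (dg hz).differentiableAt.differentiableWithinAt)
    (fun z hz => by
      refine ContinuousLinearMap.ext fun v => ?_
      have h2 := congrFun (hl z hz v) 2
      simp only [leftDeriv, maurerCartan, Matrix.cons_val] at h2
      rw [fderiv_coord (df hz), fderiv_coord (dF hz), fderiv_coord (df hz), fderiv_coord (dF hz),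
        fderiv_coord (df hz), fderiv_coord (dF hz), e0 hz, e1 hz] at h2
      have v0 : F z 0 = f z 0 + c0 := hc0 hz
      have v1 : F z 1 = f z 1 + c1 := hc1 hz
      rw [v0, v1] at h2
      rw [(dg hz).fderiv]
      simp
      linarith)
  refine ⟨![c0, c1, c2], fun z hz => ?_⟩
  have v0 : F z 0 = f z 0 + c0 := hc0 hz
  have v1 : F z 1 = f z 1 + c1 := hc1 hz
  have v2 : F z 2 = _ := hc2 hz
  funext k
  fin_cases k <;> simp [nilMul, v0, v1, v2]
  · ring
  · ring
  · ring

end Translation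

/-! ### The dual surface -/

section DualSurface

variable {V : Set ℂ} {f F n : ℂ → Vec3} {p q B s : ℂ → ℂ} {h : ℂ → ℝ} {z : ℂ}

/-- The dual spinors generate the maps with Maurer-Cartan form `16 B h⁻² conj φ`. -/
lemma isGeneratingSpinors_dual (hV : IsOpen V) (hgen : IsGeneratingSpinors V f p q)
    (hs : IsSqrtBranch V B s) (hh : ContDiffOn ℝ ∞ h V) (hne : ∀ z ∈ V, h z ≠ 0)
    (hF : ∀ z ∈ V, ∀ k, mcZ F z k = 16 * B z / (h z : ℂ) ^ 2 * conj (mcZ f z k)) :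
    IsGeneratingSpinors V F (dualSpinor₁ s h q) (dualSpinor₂ s h p) := by
  have ss : ContDiffOn ℝ ∞ s V :=
    ((hs.1.analyticOnNhd hV).contDiffOn_of_completeSpace (n := ∞)).restrict_scalars ℝ
  have hinv : ContDiffOn ℝ ∞ (fun z => ((h z : ℂ))⁻¹) V :=
    hh.complex_ofReal.inv fun z hz => Complex.ofReal_ne_zero.2 (hne z hz)
  have val {z : ℂ} (hz : z ∈ V) : B z = -(s z) ^ 2 := by rw [hs.2 z hz, neg_neg]
  refine ⟨?_, ?_, fun z hz => ?_, fun z hz => ?_, fun z hz => ?_⟩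
  · have : ContDiffOn ℝ ∞ (fun z => 4 * s z * ((h z : ℂ))⁻¹ * q z) V :=
      ((contDiffOn_const.mul ss).mul hinv).mul hgen.smooth₂
    exact this.congr fun z _ => by rw [dualSpinor₁, div_eq_mul_inv]
  · have : ContDiffOn ℝ ∞ (fun z => 4 * conj (s z) * ((h z : ℂ))⁻¹ * p z) V :=
      ((contDiffOn_const.mul ss.complex_conj).mul hinv).mul hgen.smooth₁
    exact this.congr fun z _ => by rw [dualSpinor₂, div_eq_mul_inv]
  all_goals
    rw [hF z hz, val hz, dualSpinor₁, dualSpinor₂]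
    first | rw [hgen.phi₁ z hz] | rw [hgen.phi₂ z hz] | rw [hgen.phi₃ z hz]
    have h0 : (h z : ℂ) ≠ 0 := Complex.ofReal_ne_zero.2 (hne z hz)
    simp only [map_mul, map_add, map_sub, map_pow, map_div₀, Complex.conj_conj, Complex.conj_I,
      Complex.conj_ofReal, map_ofNat]
    field_simp
    ring

/-- A map with the Maurer-Cartan form of the dual surface is a dual surface. -/
lemma isDualSurface_of_mcZ (hFs : ContDiffOn ℝ ∞ F V)
    (hgen : ∀ z ∈ V, ∀ W ⊆ V, IsOpen W → z ∈ W → ∀ χ₁ χ₂, IsGeneratingSpinors W f χ₁ χ₂ →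
      abreschRosenberg χ₁ χ₂ z = B z)
    (hh : ContDiffOn ℝ ∞ (supportFn f n) V) (hne : ∀ z ∈ V, supportFn f n z ≠ 0)
    (hF : ∀ z ∈ V, ∀ k, mcZ F z k = 16 * B z / (supportFn f n z : ℂ) ^ 2 * conj (mcZ f z k)) :
    IsDualSurface V f n F := by
  refine ⟨hFs, fun W hW hWo χ₁ χ₂ s hχ hs => ?_⟩
  refine isGeneratingSpinors_dual hWo hχ hs (hh.mono hW) (fun z hz => hne z (hW hz))
    fun z hz k => ?_
  rw [hF z (hW hz), hgen z (hW hz) W hW hWo hz χ₁ χ₂ hχ]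

/-- The dual spinors have the same Abresch-Rosenberg differential. -/
lemma abreschRosenberg_dual (hV : IsOpen V) (hf : IsConformalMaximal V f)
    (hgen : IsGeneratingSpinors V f p q) (hs : IsSqrtBranch V B s) (hh : ContDiffOn ℝ ∞ h V)
    (hne : ∀ z ∈ V, h z ≠ 0) (hsq : ∀ z ∈ V, h z ^ 2 = 4 * (‖p z‖ ^ 2 + ‖q z‖ ^ 2) ^ 2)
    (hz : z ∈ V) : abreschRosenberg (dualSpinor₁ s h q) (dualSpinor₂ s h p) z = B z := by
  have ss : ContDiffOn ℝ ∞ s V :=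
    ((hs.1.analyticOnNhd hV).contDiffOn_of_completeSpace (n := ∞)).restrict_scalars ℝ
  have hinv : ContDiffOn ℝ ∞ (fun z => ((h z : ℂ))⁻¹) V :=
    hh.complex_ofReal.inv fun z hz => Complex.ofReal_ne_zero.2 (hne z hz)
  have sc : ContDiffOn ℝ ∞ (fun z => 4 * s z / (h z : ℂ)) V := by
    simp only [div_eq_mul_inv]
    exact (contDiffOn_const.mul ss).mul hinv
  have dc := sc.differentiableAt_of_isOpen hV hz
  have dp := hgen.smooth₁.differentiableAt_of_isOpen hV hz
  have dq := hgen.smooth₂.differentiableAt_of_isOpen hV hz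
  obtain ⟨d1, d2⟩ := hf.dirac hV hgen hz
  have e2 : (fun ζ => conj (dualSpinor₂ s h p ζ)) =
      fun ζ => 4 * s ζ / (h ζ : ℂ) * conj (p ζ) := by
    funext ζ
    simp only [dualSpinor₂, map_mul, map_div₀, Complex.conj_conj, Complex.conj_ofReal, map_ofNat]
  have e1 : dualSpinor₁ s h q = fun ζ => 4 * s ζ / (h ζ : ℂ) * q ζ := rfl
  have e3 := congrFun e2 z
  rw [abreschRosenberg, e3, e2, e1, dZ_mul dc dp.complex_conj, dZ_mul dc dq, dZ_conj dp, d1, d2]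
  have h0 : (h z : ℂ) ≠ 0 := Complex.ofReal_ne_zero.2 (hne z hz)
  have hsq' : (h z : ℂ) ^ 2 = 4 * (p z * conj (p z) + q z * conj (q z)) ^ 2 := by
    rw [Complex.mul_conj', Complex.mul_conj']
    exact_mod_cast hsq z hz
  have val : B z = -(s z) ^ 2 := by rw [hs.2 z hz, neg_neg]
  rw [val]
  simp only [map_mul, map_add, map_neg, Complex.conj_conj, map_div₀, map_one, map_ofNat]
  -- The derivative of the common factor cancels in the Wronskian, so its value is irrelevant.
  generalize dZ (fun ζ => 4 * s ζ / (h ζ : ℂ)) z = c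
  field_simp
  rw [hsq']
  ring

/-- Existence of the dual surface. -/
theorem exists_dual (hDo : IsOpen V) (hDs : IsSimplyConnected V) (hf : IsConformalMaximal V f)
    (hgen : IsGeneratingSpinors V f p q)
    (hsq : ∀ z ∈ V, h z ^ 2 = 4 * (‖p z‖ ^ 2 + ‖q z‖ ^ 2) ^ 2) :
    ∃ F : ℂ → Vec3, ContDiffOn ℝ ∞ F V ∧ (∀ z ∈ V, ∀ k,
      mcZ F z k = 16 * abreschRosenberg p q z / (h z : ℂ) ^ 2 * conj (mcZ f z k)) ∧
      ∀ z ∈ V, IsHarmonicAt F z := by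
  have hpair := hf.isDiracPair hDo hgen
  set W := abreschRosenberg p q with hWdef
  have hWW : halfWronskian (fun ζ => conj (q ζ)) p = W := rfl
  have hS {z : ℂ} (hz : z ∈ V) : conj (q z) * conj (conj (q z)) + p z * conj (p z) ≠ 0 := by
    rw [Complex.mul_conj', Complex.mul_conj', RCLike.norm_conj, add_comm]
    exact_mod_cast (spinorNorm_pos (hf.norm_ne hgen hz)).ne'
  obtain ⟨α, β, sα, sβ, hαβ, heq⟩ := hpair.exists_normalised hDo fun z hz => hS hz
  have sW : ContDiffOn ℝ ∞ W V := halfWronskian_contDiffOn hDo hpair.smooth₁ hpair.smooth₂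
  -- This is `16 B h⁻² φ̄` rewritten with `h² = 4S²`, `ā = S α` and `b̄ = S β`.
  let P : Fin 3 → ℂ → ℂ := ![fun w => 4 * (W w * (α w ^ 2 - β w ^ 2)),
    fun w => -4 * Complex.I * (W w * (α w ^ 2 + β w ^ 2)),
    fun w => -8 * Complex.I * (W w * (α w * β w))]
  have hP (k : Fin 3) : ContDiffOn ℝ ∞ (P k) V := by
    fin_cases k
    · exact contDiffOn_const.mul (sW.mul ((sα.pow 2).sub (sβ.pow 2)))
    · exact contDiffOn_const.mul (sW.mul ((sα.pow 2).add (sβ.pow 2)))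
    · exact contDiffOn_const.mul (sW.mul (sα.mul sβ))
  have hharm (z : ℂ) (hz : z ∈ V) := dual_harmonic_equations (P₀ := P 0) (P₁ := P 1) (P₂ := P 2)
    (sα.differentiableAt_of_isOpen hDo hz) (sβ.differentiableAt_of_isOpen hDo hz)
    (sW.differentiableAt_of_isOpen hDo hz) (heq z hz).1 (heq z hz).2
    (hpair.dZbar_halfWronskian hDo hz) rfl rfl rfl
  obtain ⟨F, hF, hFP⟩ := exists_mcZ_eq hDo hDs hP
    (fun z hz => by rw [(hharm z hz).1, Complex.ofReal_im])
    (fun z hz => by rw [(hharm z hz).2.1, Complex.neg_im, Complex.ofReal_im, neg_zero])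
    (fun z hz => by rw [(hharm z hz).2.2, Complex.mul_im]; simp)
  refine ⟨F, hF, fun z hz k => ?_, fun z hz => ?_⟩
  · rw [hFP z hz k]
    obtain ⟨ea, eb⟩ := hαβ z hz
    set S := conj (q z) * conj (conj (q z)) + p z * conj (p z) with hSdef
    have hS0 : S ≠ 0 := hS hz
    have hsq' : (h z : ℂ) ^ 2 = 4 * S ^ 2 := by
      rw [hSdef, Complex.mul_conj', Complex.mul_conj', RCLike.norm_conj, add_comm]
      exact_mod_cast hsq z hz
    rw [hsq']
    rw [Complex.conj_conj] at ea
    fin_cases k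
    · change 4 * (W z * (α z ^ 2 - β z ^ 2)) = _ * conj (mcZ f z 0)
      rw [hgen.phi₁ z hz]
      simp only [map_sub, map_pow, Complex.conj_conj]
      rw [ea, eb]
      field_simp
      ring
    · change -4 * Complex.I * (W z * (α z ^ 2 + β z ^ 2)) = _ * conj (mcZ f z 1)
      rw [hgen.phi₂ z hz]
      simp only [map_mul, map_add, map_pow, Complex.conj_conj, Complex.conj_I]
      rw [ea, eb]
      field_simp
      ring
    · change -8 * Complex.I * (W z * (α z * β z)) = _ * conj (mcZ f z 2)
      rw [hgen.phi₃ z hz]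
      simp only [map_mul, Complex.conj_conj, Complex.conj_I, map_ofNat]
      rw [ea, eb]
      field_simp
      ring
  · rw [IsHarmonicAt, hFP z hz, hFP z hz, hFP z hz,
      dZbar_congr_of_isOpen hDo (fun w hw => hFP w hw 0) hz,
      dZbar_congr_of_isOpen hDo (fun w hw => hFP w hw 1) hz,
      dZbar_congr_of_isOpen hDo (fun w hw => hFP w hw 2) hz]
    exact hharm z hz

/-- The zeros of `B` are branch points of the dual surface. -/
theorem isBranchPoint_dual (hV : IsOpen V) (hVc : IsPreconnected V) (hf : IsConformalMaximal V f)
    (hB : DifferentiableOn ℂ B V) (hBne : ∃ z ∈ V, B z ≠ 0) (hh : ContDiffOn ℝ ∞ h V)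
    (hne : ∀ z ∈ V, h z ≠ 0)
    (hF : ∀ z ∈ V, ∀ k, mcZ F z k = 16 * B z / (h z : ℂ) ^ 2 * conj (mcZ f z k))
    (hz : z ∈ V) (hBz : B z = 0) : IsBranchPoint F z := by
  have han := hB.analyticOnNhd hV
  -- Here `k` is the order of the zero of `B`, finite because `B` does not vanish identically on a
  -- connected set.
  obtain ⟨k, g, hg, hg0, hgB⟩ := (han z hz).exists_eventuallyEq_pow_smul_nonzero_iff.2 (by
    intro hev
    obtain ⟨w, hw, hBw⟩ := hBne
    exact hBw (han.eqOn_zero_of_preconnected_of_eventuallyEq_zero hVc hz hev hw))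
  refine ⟨k, ?_, fun w i => 16 * g w / (h w : ℂ) ^ 2 * conj (mcZ f w i), ?_, ?_, ?_⟩
  · rw [Nat.one_le_iff_ne_zero]
    rintro rfl
    have := hgB.self_of_nhds
    rw [hBz] at this
    simp at this
    exact hg0 this.symm
  · refine contDiffAt_pi.2 fun i => ?_
    have sg : ContDiffAt ℝ ∞ g z := (hg.contDiffAt (n := ∞)).restrict_scalars ℝ
    have sh := hh.complex_ofReal.contDiffAt (hV.mem_nhds hz)
    have shi : ContDiffAt ℝ ∞ (fun w => ((h w : ℂ) ^ 2)⁻¹) z :=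
      (sh.pow 2).inv (pow_ne_zero 2 (Complex.ofReal_ne_zero.2 (hne z hz)))
    have sm := ((mcZ_contDiffOn hV hf.smooth i).complex_conj).contDiffAt (hV.mem_nhds hz)
    simp only [div_eq_mul_inv]
    exact ((contDiffAt_const.mul sg).mul shi).mul sm
  · refine linearIndependent_dual (l := 16 * g z / (h z : ℂ) ^ 2) (fun _ => rfl) ?_
      (hf.spacelike z hz) (hf.conformal z hz)
    exact div_ne_zero (mul_ne_zero (by norm_num) hg0)
      (pow_ne_zero 2 (Complex.ofReal_ne_zero.2 (hne z hz)))
  · filter_upwards [hgB, hV.mem_nhds hz] with w hw hwV i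
    rw [hF w hwV, hw, smul_eq_mul]
    ring

end DualSurface

/-! ### Uniqueness of the unit normal field. -/

section UnitNormals

variable {R : Set ℂ} {f n m : ℂ → Vec3} {p q : ℂ → ℂ}

/-- On a domain the unit normal field is unique up to a global sign. -/
theorem IsUnitNormal.eq_or_eq_neg (hRc : IsPreconnected R) (hf : IsConformalMaximal R f)
    (h : IsGeneratingSpinors R f p q) (hn : IsUnitNormal R f n) (hm : IsUnitNormal R f m) :
    (∀ z ∈ R, m z = n z) ∨ (∀ z ∈ R, m z = -n z) := by
  have hpt (z : ℂ) (hz : z ∈ R) :=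
    h.unitNormal_eq_or hz (hf.norm_ne h hz) (hn.2 z hz) (hm.2 z hz)
  -- The third component of a timelike normal never vanishes, so this product has constant sign on a
  -- connected set and decides between the two normals globally.
  have hc : ContinuousOn (fun z => m z 2 * n z 2) R :=
    (contDiffOn_coord hm.1 2).continuousOn.mul (contDiffOn_coord hn.1 2).continuousOn
  have hne : ∀ z ∈ R, m z 2 * n z 2 ≠ 0 := by
    intro z hz
    obtain ⟨h0, h1 | h1⟩ := hpt z hz <;> rw [h1]
    · exact mul_ne_zero h0 h0
    · exact mul_ne_zero (neg_ne_zero.2 h0) h0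
  have hsign : (∀ z ∈ R, 0 < m z 2 * n z 2) ∨ (∀ z ∈ R, m z 2 * n z 2 < 0) := by
    by_contra hcon
    push Not at hcon
    obtain ⟨⟨x, hx, hx0⟩, y, hy, hy0⟩ := hcon
    obtain ⟨w, hw, hw0⟩ := hRc.intermediate_value hx hy hc ⟨hx0, hy0⟩
    exact hne w hw hw0
  refine hsign.imp (fun hs z hz => ?_) (fun hs z hz => ?_)
  · refine (hpt z hz).2.resolve_right fun h1 => ?_
    have := hs z hz
    rw [h1, Pi.neg_apply] at this
    nlinarith [mul_self_nonneg (n z 2)]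
  · refine (hpt z hz).2.resolve_left fun h1 => ?_
    have := hs z hz
    rw [h1] at this
    nlinarith [mul_self_nonneg (n z 2)]

end UnitNormals

/-! ### Maximality and support function of the dual surface. -/

section DualOfMcZ

variable {R : Set ℂ} {f n F : ℂ → Vec3} {p q B : ℂ → ℂ} {h : ℂ → ℝ} {z : ℂ}

lemma norm_dual_factor (b : ℂ) (x : ℝ) : ‖16 * b / (x : ℂ) ^ 2‖ = 16 * ‖b‖ / x ^ 2 := by
  rw [norm_div, norm_mul, norm_pow, Complex.norm_real, Real.norm_eq_abs, sq_abs]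
  simp

/-- The dual surface is a conformal maximal immersion away from the zeros of `B`. -/
theorem isConformalMaximal_dual (hR : IsOpen R) (hf : IsConformalMaximal R f)
    (hFs : ContDiffOn ℝ ∞ F R) (hl : ∀ z ∈ R, 16 * B z / (h z : ℂ) ^ 2 ≠ 0)
    (hF : ∀ z ∈ R, ∀ k, mcZ F z k = 16 * B z / (h z : ℂ) ^ 2 * conj (mcZ f z k))
    (hharm : ∀ z ∈ R, IsHarmonicAt F z) : IsConformalMaximal R F := by
  have hsp (z : ℂ) (hz : z ∈ R) : 0 < metricFactor F z := by
    rw [metricFactor_dual (hF z hz) (hf.conformal z hz)]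
    have := norm_pos_iff.2 (hl z hz)
    have := hf.spacelike z hz
    positivity
  have hco (z : ℂ) (hz : z ∈ R) := conformal_dual (hF z hz) (hf.conformal z hz)
  refine ⟨hFs, hsp, hco, fun z hz m _ => ?_⟩
  rw [meanCurvature_eq_zero_iff (hsp z hz) (hco z hz), (isHarmonicAt_iff hR hFs hz).1 (hharm z hz)]
  simp [lor]

/-- With the same normal, only `e^{u/2}` changes, by the factor `|l| = 16 |B| / h²`. -/
lemma supportFn_dual (hf : IsConformalMaximal R f) {m : ℂ → Vec3} (hm : ∀ z ∈ R, m z = n z)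
    (hF : ∀ z ∈ R, ∀ k, mcZ F z k = 16 * B z / (supportFn f n z : ℂ) ^ 2 * conj (mcZ f z k))
    (hne : ∀ z ∈ R, supportFn f n z ≠ 0) (hz : z ∈ R) :
    supportFn F m z = 16 * ‖B z‖ / supportFn f n z := by
  have hmf := metricFactor_dual (hF z hz) (hf.conformal z hz)
  rw [norm_dual_factor] at hmf
  have h0 := hne z hz
  rw [supportFn_eq F, hmf, Real.sqrt_mul (sq_nonneg _), Real.sqrt_sq (by positivity), hm z hz]
  have e : Real.sqrt (metricFactor f z) * n z 2 = -supportFn f n z := by rw [supportFn_eq, neg_neg]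
  rw [mul_assoc, e]
  field_simp

end DualOfMcZ

end NilDual

/-! ### The duality theorem. -/

open NilDual in
theorem mainTheorem1 (D : Set ℂ) (hDo : IsOpen D) (hDs : IsSimplyConnected D)
    (f n : ℂ → Vec3) (ψ₁ ψ₂ : ℂ → ℂ)
    (hf : IsConformalMaximal D f)
    (hn : IsUnitNormal D f n)
    (hψ : IsGeneratingSpinors D f ψ₁ ψ₂)
    (B : ℂ → ℂ) (hBdef : B = abreschRosenberg ψ₁ ψ₂)
    (h : ℂ → ℝ) (hhdef : h = supportFn f n)
    (R : Set ℂ) (hRdef : R = {z | z ∈ D ∧ B z ≠ 0})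
    (hB : ∃ z ∈ D, B z ≠ 0) :
    -- local branches of the square root of `-B` exist around every point where `B ≠ 0`
    (∀ z₀ ∈ R, ∃ V ⊆ R, IsOpen V ∧ z₀ ∈ V ∧ ∃ s, IsSqrtBranch V B s) ∧
    ∃ fs : ℂ → Vec3,
      -- `fs` is generated by the dual spinors
      IsDualSurface D f n fs ∧
      (∀ V ⊆ D, IsOpen V → ∀ s, IsSqrtBranch V B s →
        IsGeneratingSpinors V fs (dualSpinor₁ s h ψ₂) (dualSpinor₂ s h ψ₁)) ∧
      -- it is a maximal immersion away from the zeros of `B`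
      IsConformalMaximal R fs ∧
      -- its Dirac potential
      (∀ V ⊆ R, IsOpen V → ∀ χ₁ χ₂, IsGeneratingSpinors V fs χ₁ χ₂ →
        SatisfiesDirac V (fun z => ((-(4 * ‖B z‖ / |h z|) : ℝ) : ℂ)) χ₁ χ₂) ∧
      -- its left-translated unit normal is that of `f` up to sign
      IsUnitNormal R fs n ∧
      (∀ ns, IsUnitNormal R fs ns →
        (∀ z ∈ R, ns z = n z) ∨ (∀ z ∈ R, ns z = -n z)) ∧
      -- metric, support function, Abresch-Rosenberg differential, normal Gauss map
      (∀ z ∈ D, metricFactor fs z = 16 ^ 2 * ‖B z‖ ^ 2 / h z ^ 4 * metricFactor f z) ∧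
      (∀ ns, IsUnitNormal R fs ns → (∀ z ∈ R, ns z = n z) →
        ∀ z ∈ R, supportFn fs ns z = 16 * ‖B z‖ / h z ∧ gaussMap ns z = gaussMap n z) ∧
      (∀ V ⊆ R, IsOpen V → ∀ χ₁ χ₂, IsGeneratingSpinors V fs χ₁ χ₂ →
        ∀ z ∈ V, abreschRosenberg χ₁ χ₂ z = B z) ∧
      -- the double dual is `f` up to a rigid motion
      IsDualSurface R fs n f ∧
      (∀ fss, IsDualSurface R fs n fss →
        ∃ p : Vec3, IsRigidMotion (nilMul p) ∧ ∀ z ∈ R, fss z = nilMul p (f z)) ∧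
      -- the zeros of `B` are branch points
      (∀ z ∈ D, B z = 0 → IsBranchPoint fs z) := by
  have hDc : IsPreconnected D := hDs.isPathConnected.isConnected.isPreconnected
  have hBd : DifferentiableOn ℂ B D := by
    rw [hBdef]; exact (hf.isDiracPair hDo hψ).differentiableOn_halfWronskian hDo
  have hRD : R ⊆ D := by rw [hRdef]; exact fun z hz => hz.1
  have hBR {z : ℂ} (hz : z ∈ R) : B z ≠ 0 := by rw [hRdef] at hz; exact hz.2
  have hRo : IsOpen R := by
    rw [hRdef]; exact hBd.continuousOn.isOpen_inter_preimage hDo isOpen_ne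
  have hRc : IsPreconnected R := by
    rw [hRdef]; exact isPreconnected_ne_zero hDo hDc hBd hB
  have hbranch : ∀ z₀ ∈ R, ∃ V ⊆ R, IsOpen V ∧ z₀ ∈ V ∧ ∃ s, IsSqrtBranch V B s :=
    fun z₀ hz₀ => exists_isSqrtBranch hRo (hBd.mono hRD) hz₀ (hBR hz₀)
  refine ⟨hbranch, ?_⟩
  have hh : ContDiffOn ℝ ∞ h D := by rw [hhdef]; exact hf.supportFn_contDiffOn hDo hn.1
  have hne : ∀ z ∈ D, h z ≠ 0 := fun z hz => by
    rw [hhdef]; exact hf.supportFn_ne_zero hψ hz (hn.2 z hz)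
  have hsq : ∀ z ∈ D, h z ^ 2 = 4 * (‖ψ₁ z‖ ^ 2 + ‖ψ₂ z‖ ^ 2) ^ 2 := fun z hz => by
    rw [hhdef]; exact hf.supportFn_sq hψ hz (hn.2 z hz)
  obtain ⟨fs, hfs, hmc, hharm⟩ := exists_dual hDo hDs hf hψ hsq
  rw [← hBdef] at hmc
  have hl : ∀ z ∈ R, 16 * B z / (h z : ℂ) ^ 2 ≠ 0 := fun z hz =>
    div_ne_zero (mul_ne_zero (by norm_num) (hBR hz))
      (pow_ne_zero 2 (Complex.ofReal_ne_zero.2 (hne z (hRD hz))))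
  have hdual : ∀ V ⊆ D, IsOpen V → ∀ s, IsSqrtBranch V B s →
      IsGeneratingSpinors V fs (dualSpinor₁ s h ψ₂) (dualSpinor₂ s h ψ₁) := fun V hV hVo s hs =>
    isGeneratingSpinors_dual hVo (hψ.mono hV) hs (hh.mono hV) (fun z hz => hne z (hV hz))
      fun z hz => hmc z (hV hz)
  have hmax : IsConformalMaximal R fs := isConformalMaximal_dual hRo (hf.mono hRD) (hfs.mono hRD) hl
    (fun z hz => hmc z (hRD hz)) fun z hz => hharm z (hRD hz)
  have hnfs : IsUnitNormal R fs n := ⟨hn.1.mono hRD, fun z hz =>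
    (isUnitNormalAt_dual (hmc z (hRD hz)) (hl z hz) _).2 (hn.2 z (hRD hz))⟩
  have hsupp : ∀ ns : ℂ → Vec3, (∀ z ∈ R, ns z = n z) → ∀ z ∈ R,
      supportFn fs ns z = 16 * ‖B z‖ / h z := by
    subst hhdef
    exact fun ns hns z hz => supportFn_dual (hf.mono hRD) hns (fun z hz => hmc z (hRD hz))
      (fun z hz => hne z (hRD hz)) hz
  have hsuppn := hsupp n fun _ _ => rfl
  -- Arbitrary spinors of `fs` are compared near each point with the dual spinors of a local branch,
  -- for which the differential is computed.
  have hAR : ∀ V ⊆ R, IsOpen V → ∀ χ₁ χ₂, IsGeneratingSpinors V fs χ₁ χ₂ →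
      ∀ z ∈ V, abreschRosenberg χ₁ χ₂ z = B z := by
    intro V hV hVo χ₁ χ₂ hχ z hz
    obtain ⟨W, hWR, hWo, hzW, s, hs⟩ := hbranch z (hV hz)
    have hWD := hWR.trans hRD
    have hVW := hVo.inter hWo
    have hzVW : z ∈ V ∩ W := ⟨hz, hzW⟩
    have hχ' := hχ.mono (W := V ∩ W) Set.inter_subset_left
    rw [abreschRosenberg_congr hVW hχ' ((hdual W hWD hWo s hs).mono Set.inter_subset_right) hzVW
      ((hmax.mono (Set.inter_subset_left.trans hV)).spinor_ne_zero hχ' hzVW)]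
    exact abreschRosenberg_dual hWo (hf.mono hWD) (hψ.mono hWD) hs (hh.mono hWD)
      (fun w hw => hne w (hWD hw)) (fun w hw => hsq w (hWD hw)) hzW
  have hsuppne : ∀ z ∈ R, supportFn fs n z ≠ 0 := fun z hz => by
    rw [hsuppn z hz]
    exact div_ne_zero (mul_ne_zero (by norm_num) (norm_ne_zero_iff.2 (hBR hz))) (hne z (hRD hz))
  -- Dualising twice multiplies the form by `256 |B|² / (h h*)²`, which is `1` because `h h* = 16
  -- |B|`.
  have hback : ∀ z ∈ R, ∀ k,
      16 * B z / (supportFn fs n z : ℂ) ^ 2 * conj (mcZ fs z k) = mcZ f z k := by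
    intro z hz k
    have h0 : (h z : ℂ) ≠ 0 := Complex.ofReal_ne_zero.2 (hne z (hRD hz))
    have hb : (‖B z‖ : ℂ) ≠ 0 := Complex.ofReal_ne_zero.2 (norm_ne_zero_iff.2 (hBR hz))
    rw [hmc z (hRD hz), hsuppn z hz]
    simp only [map_mul, map_div₀, map_pow, Complex.conj_conj, Complex.conj_ofReal, map_ofNat]
    push_cast
    field_simp
    rw [Complex.mul_conj']
  refine ⟨fs, ?_, hdual, hmax, ?_, hnfs, ?_, ?_, ?_, hAR, ?_, ?_, ?_⟩
  · subst hhdef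
    refine isDualSurface_of_mcZ hfs (fun z hz W hW hWo hzW χ₁ χ₂ hχ => ?_) hh hne hmc
    rw [hBdef]
    exact abreschRosenberg_congr hWo hχ (hψ.mono hW) hzW ((hf.mono hW).spinor_ne_zero hχ hzW)
  · intro V hV hVo χ₁ χ₂ hχ z hz
    have hmV := hmax.mono hV
    obtain ⟨d1, d2⟩ := hmV.dirac hVo hχ hz
    -- The Dirac potential is `-(|χ₁|² + |χ₂|²)/2 = -|h*|/4`, with `h* = 16 |B| / h`.
    have ha := hmV.abs_supportFn hχ hz (hnfs.2 z (hV hz))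
    rw [hsuppn z (hV hz), abs_div, abs_of_nonneg (by positivity : 0 ≤ 16 * ‖B z‖)] at ha
    have hP : ((-(4 * ‖B z‖ / |h z|) : ℝ) : ℂ) =
        -(1 / 2) * (χ₁ z * conj (χ₁ z) + χ₂ z * conj (χ₂ z)) := by
      rw [Complex.mul_conj', Complex.mul_conj',
        show -(4 * ‖B z‖ / |h z|) = -(1 / 2) * (‖χ₁ z‖ ^ 2 + ‖χ₂ z‖ ^ 2) by
          linear_combination (-1 / 4) * ha]
      push_cast
      ring
    simp only [hP, d1, d2]
    constructor <;> ring
  · exact fun ns hns => by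
      have hgl (z : ℂ) (hz : z ∈ R) : IsUnitNormalAt f z (ns z) :=
        (isUnitNormalAt_dual (hmc z (hRD hz)) (hl z hz) _).1 (hns.2 z hz)
      exact IsUnitNormal.eq_or_eq_neg hRc (hf.mono hRD) (hψ.mono hRD)
        ⟨hn.1.mono hRD, fun z hz => hn.2 z (hRD hz)⟩ ⟨hns.1, hgl⟩
  · intro z hz
    rw [metricFactor_dual (hmc z hz) (hf.conformal z hz), norm_dual_factor]
    ring
  · intro ns _ hns z hz
    exact ⟨hsupp ns hns z hz, by rw [gaussMap, gaussMap, hns z hz]⟩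
  · refine isDualSurface_of_mcZ (B := B) (hf.smooth.mono hRD)
      (fun z _ W hW hWo hzW χ₁ χ₂ hχ => hAR W hW hWo χ₁ χ₂ hχ z hzW)
      (hmax.supportFn_contDiffOn hRo hnfs.1) hsuppne fun z hz k => (hback z hz k).symm
  · intro fss hfss
    -- Near each point of `R`, the same dual spinors of `fs` generate both `fss` and `f`, so the two
    -- forms agree. A branch for `B` serves `fs` as well, since `B* = B`.
    obtain ⟨p, hp⟩ := exists_eq_nilMul hRo hRc (hf.smooth.mono hRD) hfss.1 (by
      intro z hz k
      obtain ⟨W, hWR, hWo, hzW, s, hs⟩ := hbranch z hz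
      have hg := hdual W (hWR.trans hRD) hWo s hs
      have hs' : IsSqrtBranch W (abreschRosenberg (dualSpinor₁ s h ψ₂) (dualSpinor₂ s h ψ₁)) s :=
        ⟨hs.1, fun w hw => by rw [hAR W hWR hWo _ _ hg w hw, hs.2 w hw]⟩
      have g1 := hfss.2 W hWR hWo _ _ s hg hs'
      have g2 := isGeneratingSpinors_dual (F := f) hWo hg hs
        ((hmax.supportFn_contDiffOn hRo hnfs.1).mono hWR) (fun w hw => hsuppne w (hWR hw))
        (fun w hw k => (hback w (hWR hw) k).symm)
      fin_cases k
      · exact (g1.phi₁ z hzW).trans (g2.phi₁ z hzW).symm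
      · exact (g1.phi₂ z hzW).trans (g2.phi₂ z hzW).symm
      · exact (g1.phi₃ z hzW).trans (g2.phi₃ z hzW).symm)
    exact ⟨p, isRigidMotion_nilMul p, hp⟩
  · exact fun z hz hBz => isBranchPoint_dual hDo hDc hf hBd hB hh hne hmc hz hBz
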